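/- Fix integers $k\ge 3$, $q\ge 3$ and a real $c>0$. Let $H=H_n$ be the random $k$-uniform multi-hypergraph on $[n]$ whose $\lfloor cn\rfloor$ edges are drawn independently and uniformly, with replacement, from all $k$-subsets of $[n]$. A $q$-colouring of $H$ is a map $\sigma:[n]\to[q]$ for which no edge is monochromatic. For $\omega=\omega(n)>0$, a map $\sigma:[n]\to[q]$ is $(\omega,n)$-balanced if $\bigl|\,|\sigma^{-1}(i)|/n-1/q\,\bigr|\le \omega^{-1}n^{-1/2}$ for all $i\in[q]$, and $Z_{q,\omega}(H)$ is the number of $(\omega,n)$-balanced $q$-colourings of $H$. A loose cycle of length $\ell\ge2$ in $H$ is a set of $\ell$ edges of $H$ (repeated edges being regarded as different) that can be labelled $e_a$, $a\in\mathbb Z/\ell$, so that there are distinct vertices $v_a$, $a\in\mathbb Z/\ell$, with $e_a\cap e_b=\{v_t : t\in\{a,a+1\}\cap\{b,b+1\}\}$ for all $a\neq b$. (So for $\ell\ge3$ consecutive edges share exactly one vertex, these $\ell$ shared vertices are distinct, and other pairs of edges are disjoint; for $\ell=2$ the two edges share exactly two vertices.) Let $C_\ell$ be the number of loose cycles of length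 $\ell$ in $H$, and for $\ell\ge 2$ put $$\lambda_\ell=\frac{[ck(k-1)]^\ell}{2\ell},\qquad \delta_\ell=\frac{(-1)^\ell(q-1)}{(q^{k-1}-1)^\ell}.$$ Let $\omega(n)>0$ be any sequence with $\omega(n)\to\infty$, let $L$ be a natural number and let $x_2,\dots,x_L$ be non-negative integers. Then: 1. As $n\to\infty$ through those $n$ for which an $(\omega,n)$-balanced map exists (all large $n$ if $\omega$ grows slowly, e.g. $\omega=o(\sqrt n)$), $$\frac{\mathbb E[Z_{q,\omega}(H)\mid C_\ell=x_\ell\ \ \forall\,2\le\ell\le L]}{\mathbb E[Z_{q,\omega}(H)]}\longrightarrow\prod_{\ell=2}^L(1+\delta_\ell)^{x_\ell}\exp(-\lambda_\ell\delta_\ell).$$ 2. Given a planted balanced colouring, the cycle counts are asymptotically independent Poisson variables with means $\mu_\ell=\lambda_\ell(1+\delta_\ell)$: as $n\to\infty$, uniformly over all $(\omega,n)$-balanced maps $\sigma$, $$\mathbb P\bigl[C_\ell=x_\ell\ \ \forall\,2\le\ell\le L\ \big|\ \sigma\text{ is a }q\text{-colouring of }H\bigr]\longrightarrow\prod_{\ell=2}^L\frac{e^{-\mu_\ell}\mu_\ell^{x_\ell}}{x_\ell!}.$$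 3. $\sum_{\ell\ge2}\lambda_\ell\delta_\ell^2<\infty$ if and only if $ck(k-1)<(q^{k-1}-1)^2$; in particular, the sum is finite whenever $c\le q^{k-1}\ln q$. -/

import Mathlib

open Filter Topology
open scoped BigOperators

namespace LooseCycles

/-- The sample space of the random `k`-uniform multi-hypergraph on `n` vertices with `m` edges:
the `m` edges are drawn from the `k`-subsets of the vertex set with replacement, so an outcome is
an arbitrary function from edge labels to `k`-subsets, and all outcomes are equally likely. -/
abbrev MultiHypergraph (n k m : ℕ) : Type :=
  Fin m → {e : Finset (Fin n) // e.card = k}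

open Classical in
/-- The expectation `E[X | S]` for a uniformly random multi-hypergraph `H`: the average of `X`
over the outcomes in the event `S` (with value `0` if no outcome lies in `S`). -/
noncomputable def condMean {n k m : ℕ} (X : MultiHypergraph n k m → ℝ)
    (S : MultiHypergraph n k m → Prop) : ℝ :=
  𝔼 H with S H, X H

/-- The (unconditional) expectation `E[X]` for a uniformly random multi-hypergraph. -/
noncomputable def mean {n k m : ℕ} (X : MultiHypergraph n k m → ℝ) : ℝ :=
  𝔼 H, X H

open Classical in
/-- The conditional probability `P[S | T]` for a uniformly random multi-hypergraph. -/
noncomputable def condProb {n k m : ℕ} (S T : MultiHypergraph n k m → Prop) : ℝ :=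
  condMean (fun H => if S H then 1 else 0) T

/-- `σ` is a `q`-colouring of `H`: every edge receives more than one colour. -/
def IsColouring {n k m q : ℕ} (H : MultiHypergraph n k m) (σ : Fin n → Fin q) : Prop :=
  ∀ j : Fin m, 1 < ((H j).1.image σ).card

/-- The colour density `n⁻¹ |σ⁻¹(i)|` of the colour `i`. -/
noncomputable def density {n q : ℕ} (σ : Fin n → Fin q) (i : Fin q) : ℝ :=
  ((Finset.univ.filter fun v => σ v = i).card : ℝ) / n

/-- `σ` is `(w, n)`-balanced: every colour density is within `w⁻¹ n^{-1/2}` of `1/q`. -/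
def IsBalanced {n q : ℕ} (w : ℝ) (σ : Fin n → Fin q) : Prop :=
  ∀ i : Fin q, |density σ i - 1 / q| ≤ 1 / (w * Real.sqrt n)

open Classical in
/-- The number of `(w, n)`-balanced `q`-colourings of `H`. -/
noncomputable def balancedCount {n k m : ℕ} (q : ℕ) (w : ℝ) (H : MultiHypergraph n k m) : ℕ :=
  (Finset.univ.filter fun σ : Fin n → Fin q => IsBalanced w σ ∧ IsColouring H σ).card

/-- A set `C` of (labelled) edges of `H` is a loose cycle of length `ℓ`: it consists of `ℓ` edges
that can be put in a cyclic order `e a`, `a ∈ ℤ/ℓ`, for which there are distinct vertices `v a`,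
`a ∈ ℤ/ℓ`, such that the edge at position `a` passes through `v a` and `v (a + 1)`, and two
different edges meet only in those vertices of the list that both of them pass through. So
consecutive edges share one vertex and other pairs are disjoint if `3 ≤ ℓ`, and the two edges of
a cycle of length `2` share exactly two vertices. -/
def IsLooseCycle {n k m : ℕ} (H : MultiHypergraph n k m) (ℓ : ℕ) (C : Finset (Fin m)) : Prop :=
  ∃ (e : ZMod ℓ → Fin m) (v : ZMod ℓ → Fin n),
    Function.Injective e ∧ Function.Injective v ∧ Set.range e = (C : Set (Fin m)) ∧
    ∀ a b : ZMod ℓ, a ≠ b →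
      ((H (e a)).1 : Set (Fin n)) ∩ ((H (e b)).1 : Set (Fin n)) =
        v '' (({a, a + 1} : Set (ZMod ℓ)) ∩ {b, b + 1})

open Classical in
/-- The number of loose cycles of length `ℓ` in `H`. -/
noncomputable def cycleCount {n k m : ℕ} (ℓ : ℕ) (H : MultiHypergraph n k m) : ℕ :=
  (Finset.univ.filter fun C : Finset (Fin m) => IsLooseCycle H ℓ C).card

/-- The event that the number of loose cycles of length `ℓ` is `x ℓ` for all `2 ≤ ℓ ≤ L`. -/
def CycleEvent {n k m : ℕ} (L : ℕ) (x : ℕ → ℕ) (H : MultiHypergraph n k m) : Prop :=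
  ∀ ℓ : ℕ, 2 ≤ ℓ → ℓ ≤ L → cycleCount ℓ H = x ℓ

/-- `λ_ℓ = [c k (k - 1)]^ℓ / (2 ℓ)`. -/
noncomputable def lam (k : ℕ) (c : ℝ) (ℓ : ℕ) : ℝ :=
  (c * k * ((k : ℝ) - 1)) ^ ℓ / (2 * ℓ)

/-- `δ_ℓ = (-1)^ℓ (q - 1) / (q^(k-1) - 1)^ℓ`. -/
noncomputable def del (k q : ℕ) (ℓ : ℕ) : ℝ :=
  (-1) ^ ℓ * ((q : ℝ) - 1) / ((q : ℝ) ^ (k - 1) - 1) ^ ℓ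

/-- The probability that a Poisson variable of mean `μ` takes the value `x`. -/
noncomputable def poissonProb (μ : ℝ) (x : ℕ) : ℝ :=
  Real.exp (-μ) * μ ^ x / (x.factorial : ℝ)

end LooseCycles

/-!
Conditioning the random hypergraph on `σ` being a colouring makes its edges independent and uniform
over the `k`-sets that are bichromatic under `σ`. By Bayes' rule the quotient of expectations in
the first part is therefore a weighted average, over the balanced `σ`, of the conditional
probabilities of the second part, divided by the unconditional probability of the cycle event. Both
are limits for hypergraphs with independent edges.

In such a hypergraph the expected number of loose cycles of length `ℓ` is a sum of products of
codegrees along cyclic sequences of vertices. For edges that are bichromatic under a balanced map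
the codegree depends, up to a small error, only on whether the two colours agree, so the sum is
a multiple of the trace of the `ℓ`-th power of a `q × q` matrix `a J - b I`. Its eigenvalue on
constant vectors contributes `λ_ℓ`, and the `q - 1` others contribute `λ_ℓ δ_ℓ`.

The counts become independent Poisson variables because the events for disjoint sets of edge labels
are independent, while two different cycles with a common edge span too few vertices to occur often.
-/

namespace LooseCycles

open Finset

open Classical in
/-- The probability of the event `S` for a uniformly random element of a finite type (`0` if the
type is empty). -/
noncomputable def prob {Ω : Type*} [Fintype Ω] (S : Ω → Prop) : ℝ :=
  𝔼 ω, if S ω then 1 else 0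

section Probability

variable {Ω : Type*} [Fintype Ω] {S T R : Ω → Prop}

theorem prob_eq_card_div [DecidablePred S] :
    prob S = (#{ω | S ω} : ℝ) / Fintype.card Ω := by
  rw [prob, Fintype.expect_eq_sum_div_card, natCast_card_filter]
  congr!

theorem prob_nonneg : 0 ≤ prob S :=
  expect_nonneg fun _ _ => by split_ifs <;> simp

theorem prob_mono (h : ∀ ω, S ω → T ω) : prob S ≤ prob T := by
  refine expect_le_expect fun ω _ => ?_
  have := h ω
  split_ifs <;> simp_all

theorem prob_congr (h : ∀ ω, S ω ↔ T ω) : prob S = prob T :=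
  congrArg prob (funext fun ω => propext (h ω))

theorem prob_true [Nonempty Ω] : prob (fun _ : Ω => True) = 1 := by
  simp [prob]

open Classical in
theorem sum_prob_eq_expect {β : Type*} (s : Finset β) (S : β → Ω → Prop) :
    ∑ b ∈ s, prob (S b) = 𝔼 ω, (#{b ∈ s | S b ω} : ℝ) := by
  simp only [prob, ← expect_sum_comm, sum_boole]

theorem prob_exists_le_sum {β : Type*} (s : Finset β) (S : β → Ω → Prop) :
    prob (fun ω => ∃ b ∈ s, S b ω) ≤ ∑ b ∈ s, prob (S b) := by
  classical
  rw [sum_prob_eq_expect]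
  refine expect_le_expect fun ω _ => ?_
  split_ifs with h
  · exact_mod_cast card_pos.2 (filter_nonempty_iff.2 h)
  · positivity

theorem sum_prob_le_mul_prob {β : Type*} [Fintype β] {S : β → Ω → Prop} {T : Ω → Prop} {N : ℕ}
    (hN : ∀ ω, ∀ s : Finset β, (∀ b ∈ s, S b ω) → #s ≤ N) (hT : ∀ b ω, S b ω → T ω) :
    ∑ b, prob (S b) ≤ N * prob T := by
  classical
  rw [sum_prob_eq_expect, prob, mul_expect]
  refine expect_le_expect fun ω _ => ?_
  split_ifs with h
  · rw [mul_one]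
    exact_mod_cast hN ω _ fun b hb => (mem_filter_univ b).1 hb
  · rw [filter_false_of_mem fun b _ hb => h (hT b ω hb), card_empty, mul_zero, Nat.cast_zero]

theorem prob_le_add_of_imp_or (h : ∀ ω, S ω → T ω ∨ R ω) : prob S ≤ prob T + prob R := by
  rw [prob, prob, prob, ← expect_add_distrib]
  refine expect_le_expect fun ω _ => ?_
  have := h ω
  split_ifs <;> simp_all

theorem abs_prob_sub_prob_le (h : ∀ ω, ¬ R ω → (S ω ↔ T ω)) : |prob S - prob T| ≤ prob R := by
  rw [abs_sub_le_iff, sub_le_iff_le_add', sub_le_iff_le_add']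
  constructor <;> refine prob_le_add_of_imp_or fun ω hω => or_iff_not_imp_right.2 fun hR => ?_
  · exact (h ω hR).1 hω
  · exact (h ω hR).2 hω

theorem prob_and_eq_mul_of_dependsOn {α : Type*} {X : α → Type*} [Fintype (∀ a, X a)]
    {S T : (∀ a, X a) → Prop} {A : Set α} (hS : DependsOn S A) (hT : DependsOn T Aᶜ) :
    prob (fun H => S H ∧ T H) = prob S * prob T := by
  classical
  rcases isEmpty_or_nonempty (∀ a, X a) with hX | hX
  · simp [prob]
  -- Exchanging the coordinates outside `A` of two samples preserves the uniform distribution.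
  let exchange : (∀ a, X a) × (∀ a, X a) ≃ (∀ a, X a) × (∀ a, X a) :=
    Function.Involutive.toPerm (fun p => (A.piecewise p.1 p.2, A.piecewise p.2 p.1)) fun p => by
      ext a <;> by_cases ha : a ∈ A <;> simp [ha]
  let f (H : ∀ a, X a) : ℝ := if S H then 1 else 0
  let g (H : ∀ a, X a) : ℝ := if T H then 1 else 0
  have hf (p : (∀ a, X a) × ∀ a, X a) : f (exchange p).1 = f p.1 :=
    congrArg (fun P : Prop => if P then (1 : ℝ) else 0)
      (hS fun a ha => A.piecewise_eq_of_mem p.1 p.2 ha)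
  have hg (p : (∀ a, X a) × ∀ a, X a) : g (exchange p).1 = g p.2 :=
    congrArg (fun P : Prop => if P then (1 : ℝ) else 0)
      (hT fun a ha => A.piecewise_eq_of_notMem p.1 p.2 ha)
  calc prob (fun H => S H ∧ T H)
      = 𝔼 H, f H * g H :=
        expect_congr rfl fun H _ => by by_cases hH : S H <;> simp [f, g, hH]
    _ = 𝔼 p : (∀ a, X a) × (∀ a, X a), f p.1 * g p.1 := by
        simp only [← univ_product_univ, expect_product, Fintype.expect_const]
    _ = 𝔼 p : (∀ a, X a) × (∀ a, X a), f p.1 * g p.2 :=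
        (Fintype.expect_equiv exchange _ _ fun p => by rw [hf p, hg p]).symm
    _ = prob S * prob T := by
        rw [← univ_product_univ, expect_product, prob, prob, Fintype.expect_mul_expect]

theorem prob_forall_mem {α : Type*} {X : α → Type*} [Fintype α] [∀ a, Fintype (X a)]
    [Fintype (∀ a, X a)] (G : ∀ a, Finset (X a)) :
    prob (fun H : ∀ a, X a => ∀ a, H a ∈ G a) = ∏ a, ((#(G a) : ℝ) / Fintype.card (X a)) := by
  classical
  have hG : ({H : ∀ a, X a | ∀ a, H a ∈ G a} : Finset _) = Fintype.piFinset G := by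
    ext H
    simp [Fintype.mem_piFinset]
  have hX : Fintype.card (∀ a, X a) = ∏ a, Fintype.card (X a) := by
    rw [← Fintype.card_pi]
    congr!
  rw [prob_eq_card_div, hG, hX, Fintype.card_piFinset, prod_div_distrib]
  push_cast
  rfl

theorem prob_forall_comp_mem {α γ X : Type*} [Finite α] [Fintype γ] [Fintype X] [Nonempty X]
    [Fintype (α → X)] {e : γ → α} (he : Function.Injective e) (G : γ → Finset X) :
    prob (fun H : α → X => ∀ c, H (e c) ∈ G c) = ∏ c, ((#(G c) : ℝ) / Fintype.card X) := by
  classical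
  have := Fintype.ofFinite α
  let G' : α → Finset X := Function.extend e G fun _ => univ
  have hG' (c : γ) : G' (e c) = G c := he.extend_apply _ _ c
  have hG'_univ (a : α) (ha : a ∉ Set.range e) : G' a = univ := Function.extend_apply' _ _ _ ha
  calc prob (fun H : α → X => ∀ c, H (e c) ∈ G c)
      = prob fun H : α → X => ∀ a, H a ∈ G' a := by
        refine prob_congr fun H => ⟨fun h a => ?_, fun h c => hG' c ▸ h (e c)⟩
        by_cases ha : a ∈ Set.range e
        · obtain ⟨c, rfl⟩ := ha
          exact (hG' c).symm ▸ h c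
        · simp [hG'_univ a ha]
    _ = ∏ a, ((#(G' a) : ℝ) / Fintype.card X) := prob_forall_mem G'
    _ = ∏ c, ((#(G c) : ℝ) / Fintype.card X) := by
        refine (Fintype.prod_of_injective e he _ _ (fun a ha => ?_) fun c => by rw [hG']).symm
        simp [hG'_univ a ha]

end Probability

section PoissonApproximation

variable {Ω β J : Type*} {κ : β → J} {I : β → Ω → Prop}

open scoped Classical in
/-- The vector counting, for each type `j`, the indices `b ∈ s` of type `κ b = j` whose event `I b`
occurs at `ω`. -/
noncomputable def typeCount (κ : β → J) (I : β → Ω → Prop) (s : Finset β) (ω : Ω) (j : J) : ℕ :=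
  #{b ∈ s | κ b = j ∧ I b ω}

theorem typeCount_eq_card (s : Finset β) (ω : Ω) (j : J)
    [DecidablePred fun b => κ b = j ∧ I b ω] :
    typeCount κ I s ω j = #{b ∈ s | κ b = j ∧ I b ω} := by
  rw [typeCount]
  congr!

variable [Fintype β]

theorem typeCount_univ_eq_add_single [DecidableEq β] [DecidableEq J] {s : Finset β} {b : β} {ω : Ω}
    (hbs : b ∈ s) (hb : I b ω) (hunique : ∀ b' ∈ s, I b' ω → b' = b) :
    typeCount κ I univ ω = typeCount κ I sᶜ ω + Pi.single (κ b) 1 := by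
  classical
  funext j
  have hs : #{b' ∈ s | κ b' = j ∧ I b' ω} = (Pi.single (κ b) 1 : J → ℕ) j := by
    have : ({b' ∈ s | κ b' = j ∧ I b' ω} : Finset β) = if κ b = j then {b} else ∅ := by
      ext b'
      split_ifs <;> grind
    rw [this, Pi.single_apply]
    split_ifs <;> grind
  rw [Pi.add_apply, ← hs, typeCount_eq_card, typeCount_eq_card, ← union_compl s, filter_union,
    card_union_of_disjoint (disjoint_filter_filter disjoint_compl_right), add_comm]

theorem typeCount_compl_eq_univ [DecidableEq β] {s : Finset β} {ω : Ω} (h : ∀ b ∈ s, ¬ I b ω) :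
    typeCount κ I sᶜ ω = typeCount κ I univ ω := by
  funext j
  simp only [typeCount]
  congr 1
  ext b
  have := h b
  simp only [mem_filter, mem_compl, mem_univ, true_and, and_iff_right_iff_imp]
  tauto

variable [Fintype Ω]

/-- The error term `b₁ + b₂` of Arratia, Goldstein and Gordon for a family of events in which `I b`
depends only on the events with index in the neighbourhood `nb b`. -/
noncomputable def dependenceError [DecidableEq β] (I : β → Ω → Prop) (nb : β → Finset β) : ℝ :=
  ∑ b, (∑ b' ∈ (nb b).erase b, prob (fun ω => I b ω ∧ I b' ω) +
    ∑ b' ∈ nb b, prob (I b) * prob (I b'))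

theorem sum_prob_and_typeCount_eq [DecidableEq J] (x : J → ℕ) (j : J) :
    ∑ b with κ b = j, prob (fun ω => I b ω ∧ typeCount κ I univ ω = x) =
      x j * prob fun ω => typeCount κ I univ ω = x := by
  classical
  rw [sum_prob_eq_expect, prob, mul_expect]
  refine expect_congr rfl fun ω _ => ?_
  by_cases h : typeCount κ I univ ω = x
  · simp only [h, and_true, if_true, mul_one, filter_filter, ← congrFun h j, typeCount_eq_card]
  · simp [h]

theorem abs_prob_and_typeCount_univ_sub_le [DecidableEq β] [DecidableEq J] {s : Finset β} {b : β}
    (hb : b ∈ s) (y : J → ℕ) :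
    |prob (fun ω => I b ω ∧ typeCount κ I univ ω = y + Pi.single (κ b) 1) -
      prob (fun ω => I b ω ∧ typeCount κ I sᶜ ω = y)| ≤
      ∑ b' ∈ s.erase b, prob fun ω => I b ω ∧ I b' ω := by
  refine (abs_prob_sub_prob_le fun ω hω => and_congr_right fun hIb => ?_).trans
    (prob_exists_le_sum (s.erase b) fun b' ω => I b ω ∧ I b' ω)
  have hunique : ∀ b' ∈ s, I b' ω → b' = b := by
    by_contra! hcon
    obtain ⟨b', hb', hIb', hne⟩ := hcon
    exact hω ⟨b', mem_erase.2 ⟨hne, hb'⟩, hIb, hIb'⟩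
  rw [typeCount_univ_eq_add_single hb hIb hunique, add_left_inj]

theorem abs_prob_typeCount_compl_sub_le [DecidableEq β] (s : Finset β) (y : J → ℕ) :
    |prob (fun ω => typeCount κ I sᶜ ω = y) - prob (fun ω => typeCount κ I univ ω = y)| ≤
      ∑ b ∈ s, prob (I b) := by
  refine (abs_prob_sub_prob_le fun ω hω => ?_).trans (prob_exists_le_sum s I)
  push Not at hω
  rw [typeCount_compl_eq_univ hω]

/-- In the limit this is the recursion `(y j + 1) * P (y + e_j) = μ j * P y`, which characterizes a
vector of independent Poisson variables. -/
theorem abs_succ_mul_prob_typeCount_sub_le [DecidableEq β] [DecidableEq J] {nb : β → Finset β}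
    (hnb : ∀ b, b ∈ nb b)
    (hindep : ∀ b y, prob (fun ω => I b ω ∧ typeCount κ I (nb b)ᶜ ω = y) =
      prob (I b) * prob fun ω => typeCount κ I (nb b)ᶜ ω = y)
    (y : J → ℕ) (j : J) :
    |((y j : ℝ) + 1) * prob (fun ω => typeCount κ I univ ω = y + Pi.single j 1) -
      (∑ b with κ b = j, prob (I b)) * prob (fun ω => typeCount κ I univ ω = y)| ≤
      dependenceError I nb := by
  set P : (J → ℕ) → ℝ := fun x => prob fun ω => typeCount κ I univ ω = x with hP
  set error : β → ℝ := fun b => ∑ b' ∈ (nb b).erase b, prob (fun ω => I b ω ∧ I b' ω) +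
    ∑ b' ∈ nb b, prob (I b) * prob (I b')
  have herror_nonneg (b : β) : 0 ≤ error b :=
    add_nonneg (sum_nonneg fun _ _ => prob_nonneg)
      (sum_nonneg fun _ _ => mul_nonneg prob_nonneg prob_nonneg)
  have hterm (b : β) : |prob (fun ω => I b ω ∧ typeCount κ I univ ω = y + Pi.single (κ b) 1) -
      prob (I b) * P y| ≤ error b := by
    refine (abs_sub_le _ (prob fun ω => I b ω ∧ typeCount κ I (nb b)ᶜ ω = y) _).trans
      (add_le_add (abs_prob_and_typeCount_univ_sub_le (hnb b) y) ?_)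
    rw [hindep, ← mul_sub, abs_mul, abs_of_nonneg prob_nonneg, ← mul_sum]
    exact mul_le_mul_of_nonneg_left (abs_prob_typeCount_compl_sub_le _ y) prob_nonneg
  have hcount : ((y j : ℝ) + 1) * P (y + Pi.single j 1) =
      ∑ b with κ b = j, prob fun ω => I b ω ∧ typeCount κ I univ ω = y + Pi.single j 1 := by
    simp [sum_prob_and_typeCount_eq, hP]
  rw [hcount, sum_mul, ← sum_sub_distrib]
  calc |∑ b with κ b = j, (prob (fun ω => I b ω ∧ typeCount κ I univ ω = y + Pi.single j 1) -
        prob (I b) * P y)|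
      ≤ ∑ b with κ b = j, error b := by
        refine abs_sum_le_sum_abs _ _ |>.trans (sum_le_sum fun b hb => ?_)
        obtain rfl : κ b = j := by simpa using hb
        exact hterm b
    _ ≤ ∑ b, error b :=
        sum_le_sum_of_subset_of_nonneg (filter_subset _ _) fun b _ _ => herror_nonneg b

theorem sum_prob_eq_le_one {X : Type*} (C : Ω → X) (s : Finset X) :
    ∑ x ∈ s, prob (fun ω => C ω = x) ≤ 1 := by
  classical
  rw [sum_prob_eq_expect]
  rcases isEmpty_or_nonempty Ω with hΩ | hΩ
  · simp
  refine (expect_le_expect fun ω _ => ?_).trans_eq (Fintype.expect_const (1 : ℝ))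
  exact_mod_cast card_le_one.2 fun a ha b hb => by simp_all

theorem one_sub_le_sum_prob_typeCount [Nonempty Ω] [Fintype J] [DecidableEq J] (κ : β → J)
    (I : β → Ω → Prop) (K : ℕ) :
    1 - (∑ b, prob (I b)) / (K + 1) ≤
      ∑ x ∈ Fintype.piFinset fun _ : J => range (K + 1),
        prob fun ω => typeCount κ I univ ω = x := by
  classical
  set box := Fintype.piFinset fun _ : J => range (K + 1)
  have hsplit : 1 ≤ prob (fun ω => ∃ x ∈ box, typeCount κ I univ ω = x) +
      prob (fun ω => typeCount κ I univ ω ∉ box) := by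
    rw [← prob_true (Ω := Ω)]
    refine prob_le_add_of_imp_or fun ω _ => ?_
    simpa using em (typeCount κ I univ ω ∈ box)
  have hmarkov : prob (fun ω => typeCount κ I univ ω ∉ box) ≤ (∑ b, prob (I b)) / (K + 1) := by
    rw [le_div_iff₀ (by positivity), sum_prob_eq_expect, prob, expect_mul]
    refine expect_le_expect fun ω _ => ?_
    by_cases h : typeCount κ I univ ω ∈ box
    · simp [h]
    · obtain ⟨j, hj⟩ : ∃ j, K + 1 ≤ typeCount κ I univ ω j := by
        simpa [box, Fintype.mem_piFinset, Nat.succ_le_iff] using h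
      have hle : typeCount κ I univ ω j ≤ #{b | I b ω} := by
        rw [typeCount_eq_card]
        exact card_le_card (monotone_filter_right _ fun b _ hb => hb.2)
      rw [if_pos h, one_mul]
      exact_mod_cast hj.trans hle
  linarith [prob_exists_le_sum box fun x ω => typeCount κ I univ ω = x]

end PoissonApproximation

section PoissonLimit

variable {ι J : Type*} [DecidableEq J] {l : Filter ι} {P : ι → (J → ℕ) → ℝ} {μ : J → ℝ}

theorem exists_eq_add_single {x : J → ℕ} (hx : x ≠ 0) :
    ∃ (y : J → ℕ) (j : J), x = y + Pi.single j 1 := by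
  obtain ⟨j, hj⟩ := Function.ne_iff.1 hx
  refine ⟨x - Pi.single j 1, j, (tsub_add_cancel_of_le ?_).symm⟩
  intro i
  rcases eq_or_ne i j with rfl | hij
  · simpa using Nat.one_le_iff_ne_zero.2 hj
  · simp [hij]

variable [Fintype J]

theorem prod_pow_div_factorial_add_single (μ : J → ℝ) (y : J → ℕ) (j : J) :
    ((y j : ℝ) + 1) *
        ∏ i, μ i ^ (y + Pi.single j 1 : J → ℕ) i / ((y + Pi.single j 1 : J → ℕ) i).factorial =
      μ j * ∏ i, μ i ^ y i / (y i).factorial := by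
  have hrest : ∏ i ∈ univ.erase j,
      μ i ^ (y + Pi.single j 1 : J → ℕ) i / ((y + Pi.single j 1 : J → ℕ) i).factorial =
      ∏ i ∈ univ.erase j, μ i ^ y i / (y i).factorial :=
    prod_congr rfl fun i hi => by simp [ne_of_mem_erase hi]
  rw [← mul_prod_erase univ _ (mem_univ j), hrest,
    ← mul_prod_erase univ (fun i => μ i ^ y i / ((y i).factorial : ℝ)) (mem_univ j)]
  simp only [Pi.add_apply, Pi.single_eq_same, Nat.factorial_succ]
  push_cast
  field_simp
  ring

theorem tendsto_sub_mul_prod_of_recursion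
    (hrec : ∀ y j, Tendsto (fun i => ((y j : ℝ) + 1) * P i (y + Pi.single j 1) - μ j * P i y)
      l (𝓝 0)) (x : J → ℕ) :
    Tendsto (fun i => P i x - P i 0 * ∏ j, μ j ^ x j / (x j).factorial) l (𝓝 0) := by
  induction hn : ∑ j, x j generalizing x with
  | zero =>
    obtain rfl : x = 0 := funext fun j => sum_eq_zero_iff.1 hn j (mem_univ j)
    simpa using tendsto_const_nhds
  | succ n ih =>
    obtain ⟨y, j, rfl⟩ := exists_eq_add_single (x := x) (by rintro rfl; simp at hn)
    have hy : ∑ i, y i = n := by simpa [sum_add_distrib] using hn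
    have h := ((hrec y j).add ((ih y hy).const_mul (μ j))).div_const ((y j : ℝ) + 1)
    simp only [mul_zero, add_zero, zero_div] at h
    refine h.congr fun i => ?_
    have hprod := prod_pow_div_factorial_add_single μ y j
    rw [div_eq_iff (by positivity)]
    linear_combination P i 0 * hprod

theorem tendsto_sum_box_pow_div_factorial (μ : J → ℝ) :
    Tendsto (fun K : ℕ => ∑ x ∈ Fintype.piFinset fun _ : J => range (K + 1),
      ∏ j, μ j ^ x j / ((x j).factorial : ℝ)) atTop (𝓝 (∏ j, Real.exp (μ j))) := by
  have h (j : J) : Tendsto (fun K : ℕ => ∑ r ∈ range (K + 1), μ j ^ r / (r.factorial : ℝ)) atTop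
      (𝓝 (Real.exp (μ j))) := by
    rw [Real.exp_eq_exp_ℝ]
    exact (NormedSpace.expSeries_div_hasSum_exp (μ j)).tendsto_sum_nat.comp
      (tendsto_add_atTop_nat 1)
  refine (tendsto_finsetProd univ fun j _ => h j).congr fun K => ?_
  rw [prod_univ_sum]

/-- The recursion fixes the limit up to a constant, and the tail bound keeps mass from escaping, so
that the constant is the one normalizing the weights `∏ j, μ j ^ x j / (x j)!`. -/
theorem tendsto_zero_mul_prod_exp_of_recursion {τ : ℝ} (hnonneg : ∀ i x, 0 ≤ P i x)
    (hsum : ∀ i (s : Finset (J → ℕ)), ∑ x ∈ s, P i x ≤ 1)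
    (htail : ∀ᶠ i in l, ∀ K : ℕ, 1 - τ / (K + 1) ≤
      ∑ x ∈ Fintype.piFinset fun _ : J => range (K + 1), P i x)
    (hrec : ∀ y j, Tendsto (fun i => ((y j : ℝ) + 1) * P i (y + Pi.single j 1) - μ j * P i y)
      l (𝓝 0)) :
    Tendsto (fun i => P i 0 * ∏ j, Real.exp (μ j)) l (𝓝 1) := by
  set S : ℝ := ∏ j, Real.exp (μ j)
  set box : ℕ → Finset (J → ℕ) := fun K => Fintype.piFinset fun _ : J => range (K + 1)
  set T : ℕ → ℝ := fun K => ∑ x ∈ box K, ∏ j, μ j ^ x j / ((x j).factorial : ℝ)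
  have hbox (K : ℕ) : Tendsto (fun i => ∑ x ∈ box K, P i x - P i 0 * T K) l (𝓝 0) := by
    have := tendsto_finsetSum (box K) fun x _ => tendsto_sub_mul_prod_of_recursion hrec x
    simpa only [sum_const_zero, sum_sub_distrib, ← mul_sum] using this
  have htrunc : Tendsto (fun K : ℕ => |S - T K| + τ / ((K : ℝ) + 1)) atTop (𝓝 0) := by
    have hT : Tendsto (fun K => |S - T K|) atTop (𝓝 0) := by
      have := ((tendsto_sum_box_pow_div_factorial μ).const_sub S).abs
      rwa [sub_self, abs_zero] at this
    simpa using hT.add (tendsto_const_nhds.div_atTop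
      (tendsto_natCast_atTop_atTop.atTop_add tendsto_const_nhds))
  rw [Metric.tendsto_nhds]
  intro ε hε
  obtain ⟨K, hK⟩ := (htrunc.eventually_lt_const (half_pos hε)).exists
  filter_upwards [htail, (hbox K).abs.eventually_lt_const (u := ε / 2) (by simpa using hε)]
    with i hi hboxK
  have hzero_le : P i 0 ≤ 1 := by simpa using hsum i {0}
  have htrunc_le : |P i 0 * (S - T K)| ≤ |S - T K| := by
    rw [abs_mul, abs_of_nonneg (hnonneg i 0)]
    exact mul_le_of_le_one_left (abs_nonneg _) hzero_le
  rw [Real.dist_eq, abs_lt]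
  rw [abs_le] at htrunc_le
  rw [abs_lt] at hboxK
  constructor <;> linarith [hi K, hsum i (box K)]

theorem tendsto_prod_poissonProb_of_recursion {τ : ℝ} (hnonneg : ∀ i x, 0 ≤ P i x)
    (hsum : ∀ i (s : Finset (J → ℕ)), ∑ x ∈ s, P i x ≤ 1)
    (htail : ∀ᶠ i in l, ∀ K : ℕ, 1 - τ / (K + 1) ≤
      ∑ x ∈ Fintype.piFinset fun _ : J => range (K + 1), P i x)
    (hrec : ∀ y j, Tendsto (fun i => ((y j : ℝ) + 1) * P i (y + Pi.single j 1) - μ j * P i y)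
      l (𝓝 0)) (x : J → ℕ) :
    Tendsto (fun i => P i x) l (𝓝 (∏ j, poissonProb (μ j) (x j))) := by
  have hS : ∏ j, Real.exp (μ j) ≠ 0 := prod_ne_zero_iff.2 fun j _ => Real.exp_ne_zero _
  have hzero : Tendsto (fun i => P i 0) l (𝓝 (∏ j, Real.exp (μ j))⁻¹) := by
    simpa [mul_assoc, hS] using
      (tendsto_zero_mul_prod_exp_of_recursion hnonneg hsum htail hrec).mul_const
        (∏ j, Real.exp (μ j))⁻¹
  have hlim := (tendsto_sub_mul_prod_of_recursion hrec x).add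
    (hzero.mul_const (∏ j, μ j ^ x j / ((x j).factorial : ℝ)))
  simp only [sub_add_cancel, zero_add] at hlim
  convert hlim using 2
  rw [← prod_inv_distrib, ← prod_mul_distrib]
  refine prod_congr rfl fun j _ => ?_
  rw [poissonProb, Real.exp_neg, mul_div_assoc]

theorem tendsto_prob_typeCount {Ω β : ι → Type*} [∀ i, Fintype (Ω i)] [∀ i, Fintype (β i)]
    [∀ i, DecidableEq (β i)] {κ : ∀ i, β i → J} {I : ∀ i, β i → Ω i → Prop}
    {nb : ∀ i, β i → Finset (β i)} (hΩ : ∀ᶠ i in l, Nonempty (Ω i)) (hnb : ∀ i b, b ∈ nb i b)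
    (hindep : ∀ i b y, prob (fun ω => I i b ω ∧ typeCount (κ i) (I i) (nb i b)ᶜ ω = y) =
      prob (I i b) * prob fun ω => typeCount (κ i) (I i) (nb i b)ᶜ ω = y)
    (herror : Tendsto (fun i => dependenceError (I i) (nb i)) l (𝓝 0))
    (hmean : ∀ j, Tendsto (fun i => ∑ b with κ i b = j, prob (I i b)) l (𝓝 (μ j))) (x : J → ℕ) :
    Tendsto (fun i => prob fun ω => typeCount (κ i) (I i) univ ω = x) l
      (𝓝 (∏ j, poissonProb (μ j) (x j))) := by
  have htotal : Tendsto (fun i => ∑ b, prob (I i b)) l (𝓝 (∑ j, μ j)) :=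
    (tendsto_finsetSum univ fun j _ => hmean j).congr fun i => sum_fiberwise univ (κ i) _
  refine tendsto_prod_poissonProb_of_recursion (τ := ∑ j, μ j + 1)
    (P := fun i x => prob fun ω => typeCount (κ i) (I i) univ ω = x)
    (fun _ _ => prob_nonneg) (fun i s => sum_prob_eq_le_one _ s) ?_ (fun y j => ?_) x
  · filter_upwards [hΩ, htotal.eventually_lt_const (lt_add_one _)] with i _ hi K
    refine le_trans ?_ (one_sub_le_sum_prob_typeCount (κ i) (I i) K)
    gcongr
  · set P : ι → ℝ := fun i => prob fun ω => typeCount (κ i) (I i) univ ω = y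
    have hP (i : ι) : P i ≤ 1 := by
      simpa using sum_prob_eq_le_one (typeCount (κ i) (I i) univ) {y}
    have hdrift : Tendsto (fun i => |(∑ b with κ i b = j, prob (I i b)) - μ j|) l (𝓝 0) := by
      simpa using ((hmean j).sub_const (μ j)).abs
    refine squeeze_zero_norm (fun i => ?_) (by simpa using herror.add hdrift)
    refine (abs_sub_le _ ((∑ b with κ i b = j, prob (I i b)) * P i) _).trans
      (add_le_add (abs_succ_mul_prob_typeCount_sub_le (hnb i) (hindep i) y j) ?_)
    rw [← sub_mul, abs_mul, abs_of_nonneg prob_nonneg]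
    exact mul_le_of_le_one_right (abs_nonneg _) (hP i)

end PoissonLimit

section Cycles

variable {α V : Type*} {ℓ k : ℕ} {G : α → Finset V} {e : ZMod ℓ → α} {v : ZMod ℓ → V}

theorem forall_zmod_of_forall_add_one [NeZero ℓ] {p : ZMod ℓ → Prop} (zero : p 0)
    (add_one : ∀ a, p a → p (a + 1)) (a : ZMod ℓ) : p a := by
  have hnat : ∀ r : ℕ, p r := fun r => by
    induction r with
    | zero => simpa using zero
    | succ r ih => simpa using add_one r ih
  simpa using hnat a.val

theorem exists_mem_sub_one_notMem [NeZero ℓ] {T : Finset (ZMod ℓ)} (hT : T.Nonempty)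
    (hne : T ≠ univ) : ∃ a ∈ T, a - 1 ∉ T := by
  by_contra! hclosed
  obtain ⟨a, ha⟩ := hT
  refine hne (eq_univ_iff_forall.2 fun b => ?_)
  have hsub : ∀ c, a - c ∈ T := forall_zmod_of_forall_add_one (by simpa using ha) fun c hc => by
    simpa [sub_sub] using hclosed _ hc
  simpa using hsub (a - b)

theorem pairwise_disjoint_of_sum_card_le {ι β : Type*} [Fintype ι] [DecidableEq β]
    {f : ι → Finset β} (h : ∑ i, #(f i) ≤ #(univ.biUnion f)) :
    Pairwise fun i j => Disjoint (f i) (f j) := by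
  classical
  intro i j hij
  have hcover : univ.biUnion f ⊆ (f i ∪ f j) ∪ ((univ.erase i).erase j).biUnion f := fun x hx => by
    obtain ⟨c, -, hc⟩ := mem_biUnion.1 hx
    simp only [mem_union, mem_biUnion, mem_erase, mem_univ, and_true]
    grind
  have hle := (card_le_card hcover).trans (card_union_le _ _)
  have hrest := card_biUnion_le (s := (univ.erase i).erase j) (t := f)
  have hsum := add_sum_erase univ (fun i => #(f i)) (mem_univ i)
  have hsum' := add_sum_erase (univ.erase i) (fun i => #(f i))
    (mem_erase.2 ⟨hij.symm, mem_univ j⟩)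
  have hinter := card_union_add_card_inter (f i) (f j)
  rw [disjoint_iff_inter_eq_empty, ← card_eq_zero]
  omega

/-- The cyclic sequence of distinct edges `e a` and distinct vertices `v a` is a Berge cycle: the
edge `e a` passes through `v a` and `v (a + 1)`. Edges may have further common vertices. -/
structure IsBergeCycle (G : α → Finset V) (e : ZMod ℓ → α) (v : ZMod ℓ → V) : Prop where
  edge_injective : Function.Injective e
  vertex_injective : Function.Injective v
  mem_left : ∀ a, v a ∈ G (e a)
  mem_right : ∀ a, v (a + 1) ∈ G (e a)

/-- `e` and `v` list the edges and the connecting vertices of a loose cycle in cyclic order, in the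
sense of `IsLooseCycle`. -/
structure IsCycleOrder (G : α → Finset V) (e : ZMod ℓ → α) (v : ZMod ℓ → V) : Prop where
  edge_injective : Function.Injective e
  vertex_injective : Function.Injective v
  inter_eq : ∀ a b, a ≠ b →
    (G (e a) : Set V) ∩ G (e b) = v '' (({a, a + 1} : Set (ZMod ℓ)) ∩ {b, b + 1})

namespace IsBergeCycle

theorem card_erase [DecidableEq V] (h : IsBergeCycle G e v) (hk : ∀ j, #(G j) = k) (a : ZMod ℓ) :
    #((G (e a)).erase (v a)) = k - 1 := by
  rw [card_erase_of_mem (h.mem_left a), hk]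

theorem sum_card_erase [NeZero ℓ] [DecidableEq V] (h : IsBergeCycle G e v)
    (hk : ∀ j, #(G j) = k) :
    ∑ a, #((G (e a)).erase (v a)) = (k - 1) * ℓ := by
  simp [h.card_erase hk, ZMod.card, mul_comm]

variable [Fact (1 < ℓ)] [DecidableEq V]

theorem mem_erase_sub_one (h : IsBergeCycle G e v) (a : ZMod ℓ) :
    v a ∈ (G (e (a - 1))).erase (v (a - 1)) :=
  mem_erase.2 ⟨h.vertex_injective.ne fun ha => by simpa using sub_eq_self.1 ha.symm,
    by simpa using h.mem_right (a - 1)⟩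

theorem isCycleOrder (h : IsBergeCycle G e v)
    (hdisj : Pairwise fun a b => Disjoint ((G (e a)).erase (v a)) ((G (e b)).erase (v b))) :
    IsCycleOrder G e v := by
  have hnext : ∀ {a b : ZMod ℓ}, a ≠ b → v a ∈ G (e b) → a = b + 1 := fun {a b} hab hmem => by
    by_contra hne
    have hb : v a ∈ (G (e b)).erase (v b) := mem_erase.2 ⟨h.vertex_injective.ne hab, hmem⟩
    have hba : a - 1 ≠ b := fun hba => hne (sub_eq_iff_eq_add.1 hba)
    exact disjoint_left.1 (hdisj hba) (h.mem_erase_sub_one a) hb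
  refine ⟨h.edge_injective, h.vertex_injective, fun a b hab => ?_⟩
  ext x
  simp only [Set.mem_inter_iff, mem_coe, Set.mem_image, Set.mem_insert_iff, Set.mem_singleton_iff]
  constructor
  · rintro ⟨ha, hb⟩
    by_cases hxa : x = v a
    · exact ⟨a, ⟨Or.inl rfl, Or.inr (hnext hab (hxa ▸ hb))⟩, hxa.symm⟩
    by_cases hxb : x = v b
    · exact ⟨b, ⟨Or.inr (hnext hab.symm (hxb ▸ ha)), Or.inl rfl⟩, hxb.symm⟩
    · exact (disjoint_left.1 (hdisj hab) (mem_erase.2 ⟨hxa, ha⟩) (mem_erase.2 ⟨hxb, hb⟩)).elim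
  · rintro ⟨t, ⟨ha, hb⟩, rfl⟩
    exact ⟨ha.elim (· ▸ h.mem_left t) (· ▸ h.mem_right a),
      hb.elim (· ▸ h.mem_left t) (· ▸ h.mem_right b)⟩

variable [NeZero ℓ]

theorem biUnion_erase (h : IsBergeCycle G e v) :
    (univ.biUnion fun a => (G (e a)).erase (v a)) = univ.biUnion fun a => G (e a) := by
  refine (biUnion_mono fun a _ => erase_subset _ _).antisymm fun x hx => ?_
  obtain ⟨a, -, ha⟩ := mem_biUnion.1 hx
  rcases eq_or_ne x (v a) with rfl | hxa
  · exact mem_biUnion.2 ⟨a - 1, mem_univ _, h.mem_erase_sub_one a⟩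
  · exact mem_biUnion.2 ⟨a, mem_univ _, mem_erase.2 ⟨hxa, ha⟩⟩

theorem card_biUnion_le (h : IsBergeCycle G e v) (hk : ∀ j, #(G j) = k) :
    #(univ.biUnion fun a => G (e a)) ≤ (k - 1) * ℓ :=
  h.biUnion_erase ▸ Finset.card_biUnion_le.trans (h.sum_card_erase hk).le

theorem card_biUnion_lt_of_not_isCycleOrder (h : IsBergeCycle G e v) (hk : ∀ j, #(G j) = k)
    (hne : ¬ IsCycleOrder G e v) : #(univ.biUnion fun a => G (e a)) < (k - 1) * ℓ := by
  by_contra! hle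
  refine hne (h.isCycleOrder (pairwise_disjoint_of_sum_card_le ?_))
  rwa [h.sum_card_erase hk, h.biUnion_erase]

end IsBergeCycle

namespace IsCycleOrder

theorem exists_of_mem (h : IsCycleOrder G e v) {a b : ZMod ℓ} (hab : a ≠ b) {x : V}
    (ha : x ∈ G (e a)) (hb : x ∈ G (e b)) :
    ∃ t, (t = a ∨ t = a + 1) ∧ (t = b ∨ t = b + 1) ∧ v t = x := by
  obtain ⟨t, ⟨hta, htb⟩, rfl⟩ := (h.inter_eq a b hab).subset ⟨ha, hb⟩
  exact ⟨t, hta, htb, rfl⟩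

theorem pairwise_disjoint_erase [DecidableEq V] (h : IsCycleOrder G e v) :
    Pairwise fun a b => Disjoint ((G (e a)).erase (v a)) ((G (e b)).erase (v b)) := by
  intro a b hab
  refine disjoint_left.2 fun x ha hb => hab ?_
  obtain ⟨t, hta, htb, rfl⟩ := h.exists_of_mem hab (mem_of_mem_erase ha) (mem_of_mem_erase hb)
  have hta := hta.resolve_left fun hta => ne_of_mem_erase ha (congrArg v hta)
  have htb := htb.resolve_left fun htb => ne_of_mem_erase hb (congrArg v htb)
  exact add_right_cancel (hta.symm.trans htb)

theorem comp (h : IsCycleOrder G e v) {φ ψ : ZMod ℓ → ZMod ℓ} (hφ : Function.Injective φ)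
    (hψ : Function.Injective ψ) (hφψ : ∀ a, ψ '' {a, a + 1} = {φ a, φ a + 1}) :
    IsCycleOrder G (e ∘ φ) (v ∘ ψ) where
  edge_injective := h.edge_injective.comp hφ
  vertex_injective := h.vertex_injective.comp hψ
  inter_eq a b hab := by
    rw [Function.comp_apply, Function.comp_apply, h.inter_eq _ _ (hφ.ne hab), ← hφψ, ← hφψ,
      ← Set.image_inter hψ, Set.image_comp]

theorem shift (h : IsCycleOrder G e v) (c : ZMod ℓ) :
    IsCycleOrder G (e ∘ (c + ·)) (v ∘ (c + ·)) :=
  h.comp (add_right_injective c) (add_right_injective c) fun a => by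
    simp [Set.image_pair, add_assoc]

theorem reflect (h : IsCycleOrder G e v) (c : ZMod ℓ) :
    IsCycleOrder G (e ∘ (c - ·)) (v ∘ (c + 1 - ·)) :=
  h.comp sub_right_injective sub_right_injective fun a => by
    rw [Set.image_pair, Set.pair_comm, add_sub_add_right_eq_sub, sub_add_eq_add_sub]

variable [Fact (1 < ℓ)]

theorem isBergeCycle (h : IsCycleOrder G e v) : IsBergeCycle G e v := by
  have hmem : ∀ a, v (a + 1) ∈ (G (e a) : Set V) ∩ G (e (a + 1)) := fun a => by
    rw [h.inter_eq a (a + 1) (by simp)]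
    exact ⟨a + 1, by simp, rfl⟩
  exact ⟨h.edge_injective, h.vertex_injective, fun a => by simpa using (hmem (a - 1)).2,
    fun a => (hmem a).1⟩

theorem eq_or_eq_of_mem (h : IsCycleOrder G e v) {t b : ZMod ℓ} (ht : v t ∈ G (e b)) :
    t = b ∨ t = b + 1 := by
  refine or_iff_not_imp_left.2 fun htb => ?_
  obtain ⟨s, -, hs, hst⟩ := h.exists_of_mem htb (h.isBergeCycle.mem_left t) ht
  obtain rfl := h.vertex_injective hst
  exact hs.resolve_left htb

variable {e' : ZMod ℓ → α} {v' : ZMod ℓ → V}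

theorem add_one_eq_of_eq (h : IsCycleOrder G e v) (h' : IsCycleOrder G e' v')
    (hr : Set.range e' = Set.range e) {a : ZMod ℓ} (he : e' a = e a) (hv : v' a = v a) :
    e' (a + 1) = e (a + 1) ∧ v' (a + 1) = v (a + 1) := by
  obtain ⟨b, hb⟩ : e' (a + 1) ∈ Set.range e := hr ▸ Set.mem_range_self _
  have hab : a ≠ b := by
    rintro rfl
    simpa using h'.edge_injective (he.trans hb)
  have hmem : v' (a + 1) ∈ G (e b) := by
    simpa [hb] using h'.isBergeCycle.mem_left (a + 1)
  obtain ⟨t, hta, htb, htv⟩ := h.exists_of_mem hab (he ▸ h'.isBergeCycle.mem_right a) hmem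
  obtain rfl := hta.resolve_left fun hta => by
    simpa using h'.vertex_injective (htv.symm.trans ((congrArg v hta).trans hv.symm))
  refine ⟨?_, htv.symm⟩
  rw [← hb, htb.resolve_right fun hc => hab (add_right_cancel hc)]

variable [NeZero ℓ]

theorem lt_card_biUnion [DecidableEq V] (h : IsCycleOrder G e v) (hk : ∀ j, #(G j) = k)
    {T : Finset (ZMod ℓ)} (hT : T.Nonempty) (hne : T ≠ univ) :
    (k - 1) * #T < #(T.biUnion fun a => G (e a)) := by
  obtain ⟨a, ha, hpred⟩ := exists_mem_sub_one_notMem hT hne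
  have hcard : #(T.biUnion fun b => (G (e b)).erase (v b)) = (k - 1) * #T := by
    rw [card_biUnion fun a _ b _ hab => h.pairwise_disjoint_erase hab]
    simp [h.isBergeCycle.card_erase hk, mul_comm]
  have hva : v a ∉ T.biUnion fun b => (G (e b)).erase (v b) := fun hmem => by
    obtain ⟨b, hb, hab⟩ := mem_biUnion.1 hmem
    rcases h.eq_or_eq_of_mem (mem_of_mem_erase hab) with rfl | rfl
    · exact ne_of_mem_erase hab rfl
    · exact hpred (by simpa using hb)
  rw [← hcard]
  refine card_lt_card ⟨biUnion_mono fun b _ => erase_subset _ _, fun hle => hva (hle ?_)⟩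
  exact mem_biUnion.2 ⟨a, ha, h.isBergeCycle.mem_left a⟩

theorem eq_of_zero_eq (h : IsCycleOrder G e v) (h' : IsCycleOrder G e' v')
    (hr : Set.range e' = Set.range e) (he : e' 0 = e 0) (hv : v' 0 = v 0) : e' = e ∧ v' = v := by
  have heq : ∀ a, e' a = e a ∧ v' a = v a :=
    forall_zmod_of_forall_add_one ⟨he, hv⟩ fun a ha => h.add_one_eq_of_eq h' hr ha.1 ha.2
  exact ⟨funext fun a => (heq a).1, funext fun a => (heq a).2⟩

theorem exists_eq_shift_or_eq_reflect (h : IsCycleOrder G e v) (h' : IsCycleOrder G e' v')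
    (hr : Set.range e' = Set.range e) :
    ∃ c, (e' = e ∘ (c + ·) ∧ v' = v ∘ (c + ·)) ∨
      (e' = e ∘ (c - ·) ∧ v' = v ∘ (c + 1 - ·)) := by
  obtain ⟨c, hc⟩ : e' 0 ∈ Set.range e := hr ▸ Set.mem_range_self _
  have hmem : v' 0 ∈ G (e c) := hc ▸ h'.isBergeCycle.mem_left 0
  obtain ⟨b, hb⟩ : e' (-1) ∈ Set.range e := hr ▸ Set.mem_range_self _
  have hmem' : v' 0 ∈ G (e b) := by simpa [hb] using h'.isBergeCycle.mem_right (-1)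
  have hbc : b ≠ c := by
    rintro rfl
    simpa using h'.edge_injective (hb.symm.trans hc)
  refine ⟨c, ?_⟩
  obtain ⟨t, -, rfl | rfl, ht⟩ := h.exists_of_mem hbc hmem' hmem
  · refine Or.inl ((h.shift t).eq_of_zero_eq h' ?_ (by simp [hc]) (by simp [ht]))
    exact hr.trans ((Equiv.addLeft t).surjective.range_comp e).symm
  · refine Or.inr ((h.reflect c).eq_of_zero_eq h' ?_ (by simp [hc]) (by simp [ht]))
    exact hr.trans ((Equiv.subLeft c).surjective.range_comp e).symm

open Classical in
theorem card_filter_range_eq [Fintype α] [Fintype V] (h : IsCycleOrder G e v) :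
    #{p : (ZMod ℓ → α) × (ZMod ℓ → V) | IsCycleOrder G p.1 p.2 ∧ Set.range p.1 = Set.range e} =
      2 * ℓ := by
  let f : Bool × ZMod ℓ → (ZMod ℓ → α) × (ZMod ℓ → V) := fun p =>
    if p.1 then (e ∘ (p.2 + ·), v ∘ (p.2 + ·)) else (e ∘ (p.2 - ·), v ∘ (p.2 + 1 - ·))
  have hf : Function.Injective f := by
    rintro ⟨s, a⟩ ⟨t, b⟩ hab
    have hedge := congrFun (congrArg Prod.fst hab) 0
    have hvertex := congrFun (congrArg Prod.snd hab) 0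
    obtain rfl : a = b := h.edge_injective (by cases s <;> cases t <;> simpa [f] using hedge)
    cases s <;> cases t <;> simp [f, h.vertex_injective.eq_iff] at hvertex ⊢
  have himage : ({p : (ZMod ℓ → α) × (ZMod ℓ → V) |
      IsCycleOrder G p.1 p.2 ∧ Set.range p.1 = Set.range e} : Finset _) = univ.image f := by
    ext ⟨e', v'⟩
    simp only [mem_filter_univ, mem_image_univ_iff_mem_range, Set.mem_range, Prod.exists]
    constructor
    · rintro ⟨h', hr⟩
      obtain ⟨c, ⟨rfl, rfl⟩ | ⟨rfl, rfl⟩⟩ := h.exists_eq_shift_or_eq_reflect h' hr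
      exacts [⟨true, c, rfl⟩, ⟨false, c, rfl⟩]
    · rintro ⟨_ | _, c, hc⟩ <;> obtain ⟨rfl, rfl⟩ := Prod.ext_iff.1 hc
      exacts [⟨h.reflect c, (Equiv.subLeft c).surjective.range_comp e⟩,
        ⟨h.shift c, (Equiv.addLeft c).surjective.range_comp e⟩]
  rw [himage, card_image_of_injective _ hf]
  simp [ZMod.card]

end IsCycleOrder

/-- `C` is the set of the edges of a loose cycle of length `ℓ`, for an arbitrary family `G` of edges
in place of the multi-hypergraph of `IsLooseCycle`. -/
def IsLooseCycleOn (G : α → Finset V) (ℓ : ℕ) (C : Finset α) : Prop :=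
  ∃ (e : ZMod ℓ → α) (v : ZMod ℓ → V), IsCycleOrder G e v ∧ Set.range e = C

theorem isLooseCycle_iff_isLooseCycleOn {n m : ℕ} {H : MultiHypergraph n k m}
    {C : Finset (Fin m)} : IsLooseCycle H ℓ C ↔ IsLooseCycleOn (fun j => (H j).1) ℓ C :=
  ⟨fun ⟨e, v, he, hv, hr, hinter⟩ => ⟨e, v, ⟨he, hv, hinter⟩, hr⟩,
    fun ⟨e, v, h, hr⟩ => ⟨e, v, h.edge_injective, h.vertex_injective, hr, h.inter_eq⟩⟩

namespace IsLooseCycleOn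

variable {C : Finset α}

theorem congr {G' : α → Finset V} (hG : ∀ a ∈ C, G a = G' a) (h : IsLooseCycleOn G ℓ C) :
    IsLooseCycleOn G' ℓ C := by
  obtain ⟨e, v, h, hr⟩ := h
  have hmem : ∀ a, e a ∈ C := fun a => mem_coe.1 (hr ▸ Set.mem_range_self a)
  refine ⟨e, v, ⟨h.edge_injective, h.vertex_injective, fun a b hab => ?_⟩, hr⟩
  rw [← hG _ (hmem a), ← hG _ (hmem b), h.inter_eq a b hab]

variable [NeZero ℓ]

theorem exists_eq_image [DecidableEq α] (h : IsLooseCycleOn G ℓ C) :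
    ∃ (e : ZMod ℓ → α) (v : ZMod ℓ → V), IsCycleOrder G e v ∧ C = univ.image e := by
  obtain ⟨e, v, h, hr⟩ := h
  exact ⟨e, v, h, coe_injective (by simp [hr])⟩

theorem card_eq (h : IsLooseCycleOn G ℓ C) : #C = ℓ := by
  classical
  obtain ⟨e, v, he, rfl⟩ := h.exists_eq_image
  rw [card_image_of_injective _ he.edge_injective, card_univ, ZMod.card]

variable [Fact (1 < ℓ)] [DecidableEq V]

theorem card_biUnion_le (h : IsLooseCycleOn G ℓ C) (hk : ∀ j, #(G j) = k) :
    #(C.biUnion G) ≤ (k - 1) * #C := by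
  classical
  rw [h.card_eq]
  obtain ⟨e, v, he, rfl⟩ := h.exists_eq_image
  rw [image_biUnion]
  exact he.isBergeCycle.card_biUnion_le hk

theorem lt_card_biUnion (h : IsLooseCycleOn G ℓ C) (hk : ∀ j, #(G j) = k) {S : Finset α}
    (hS : S.Nonempty) (hSC : S ⊂ C) : (k - 1) * #S < #(S.biUnion G) := by
  classical
  obtain ⟨e, v, he, rfl⟩ := h.exists_eq_image
  obtain ⟨T, -, rfl⟩ := subset_image_iff.1 hSC.subset
  rw [card_image_of_injective _ he.edge_injective, image_biUnion]
  exact he.lt_card_biUnion hk (image_nonempty.1 hS) fun hT => hSC.ne (hT ▸ rfl)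

theorem card_biUnion_union_lt [DecidableEq α] {ℓ' : ℕ} [NeZero ℓ'] [Fact (1 < ℓ')] {B : Finset α}
    (hC : IsLooseCycleOn G ℓ C) (hB : IsLooseCycleOn G ℓ' B) (hk : ∀ j, #(G j) = k) (hne : C ≠ B)
    (hCB : ¬ Disjoint C B) : #((C ∪ B).biUnion G) < (k - 1) * #(C ∪ B) := by
  have hinter : (C ∩ B).Nonempty := not_disjoint_iff_nonempty_inter.1 hCB
  have hlow : (k - 1) * #(C ∩ B) < #((C ∩ B).biUnion G) := by
    rcases (inter_subset_left : C ∩ B ⊆ C).eq_or_ssubset with h | h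
    · refine hB.lt_card_biUnion hk hinter (inter_subset_right.ssubset_of_ne fun h' => hne ?_)
      exact h.symm.trans h'
    · exact hC.lt_card_biUnion hk hinter h
  have hle : #((C ∩ B).biUnion G) ≤ #(C.biUnion G ∩ B.biUnion G) :=
    card_le_card (subset_inter
      (biUnion_subset_biUnion_of_subset_left _ inter_subset_left)
      (biUnion_subset_biUnion_of_subset_left _ inter_subset_right))
  have hvertices := card_union_add_card_inter (C.biUnion G) (B.biUnion G)
  have hedges := congrArg ((k - 1) * ·) (card_union_add_card_inter C B)
  simp only [mul_add] at hedges
  have hC' := hC.card_biUnion_le hk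
  have hB' := hB.card_biUnion_le hk
  rw [union_biUnion]
  omega

end IsLooseCycleOn

end Cycles

section RandomFamily

/-- The number of edges `E x` through both vertices `u` and `w`. -/
noncomputable def codegree {X V : Type*} [Fintype X] (E : X → Finset V) (u w : V) : ℕ := by
  classical exact #{x | u ∈ E x ∧ w ∈ E x}

variable {α V X : Type*} {k ℓ N : ℕ}

section Deterministic

variable [NeZero ℓ] {G : α → Finset V}

theorem card_le_of_forall_isBergeCycle (hk : ∀ j, #(G j) = k) (e : ZMod ℓ → α)
    (s : Finset (ZMod ℓ → V)) (hs : ∀ v ∈ s, IsBergeCycle G e v) : #s ≤ k ^ ℓ := by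
  classical
  have hle : #s ≤ #(Fintype.piFinset fun a => G (e a)) :=
    card_le_card fun v hv => Fintype.mem_piFinset.2 (hs v hv).mem_left
  simpa [hk, ZMod.card] using hle

open Classical in
theorem card_isCycleOrder [Fact (1 < ℓ)] [Fintype α] [Fintype V] (G : α → Finset V) :
    #{p : (ZMod ℓ → α) × (ZMod ℓ → V) | IsCycleOrder G p.1 p.2} =
      2 * ℓ * #{A : Finset α | IsLooseCycleOn G ℓ A} := by
  rw [card_eq_sum_card_fiberwise (f := fun p => univ.image p.1)
    (t := {A : Finset α | IsLooseCycleOn G ℓ A}), sum_const_nat (m := 2 * ℓ), mul_comm]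
  · intro A hA
    obtain ⟨e, v, h, hr⟩ := (mem_filter_univ A).1 hA
    rw [← h.card_filter_range_eq, filter_filter]
    refine congrArg card (filter_congr fun p _ => and_congr_right fun _ => ?_)
    rw [hr, ← coe_inj, coe_image, coe_univ, Set.image_univ]
  · intro p hp
    rw [coe_filter_univ] at hp ⊢
    exact ⟨p.1, p.2, hp, by simp⟩

end Deterministic

variable [Fintype α] [DecidableEq α] [Fintype X] {E : X → Finset V}

theorem prob_isBergeCycle [NeZero ℓ] [Nonempty X] {e : ZMod ℓ → α}
    (he : Function.Injective e) {v : ZMod ℓ → V} (hv : Function.Injective v) :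
    prob (fun H : α → X => IsBergeCycle (fun a => E (H a)) e v) =
      ∏ a, ((codegree E (v a) (v (a + 1)) : ℝ) / Fintype.card X) := by
  classical
  refine Eq.trans ?_ (prob_forall_comp_mem he fun a => {x | v a ∈ E x ∧ v (a + 1) ∈ E x})
  refine prob_congr fun H => ⟨fun h a => by simpa using ⟨h.mem_left a, h.mem_right a⟩, fun h => ?_⟩
  simp only [mem_filter_univ] at h
  exact ⟨he, hv, fun a => (h a).1, fun a => (h a).2⟩

variable [Fintype V]

theorem prob_card_biUnion_le [DecidableEq V] [Nonempty X] (hE : Function.Injective E)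
    (U : Finset α) (hN : N ≤ Fintype.card V) :
    prob (fun H : α → X => #(U.biUnion fun a => E (H a)) ≤ N) ≤
      (Fintype.card V : ℝ) ^ N * (2 ^ N / Fintype.card X) ^ #U := by
  have hinside : ∀ W ∈ powersetCard N (univ : Finset V),
      prob (fun H : α → X => ∀ c : U, H c ∈ ({x | E x ⊆ W} : Finset X)) ≤
        (2 ^ N / Fintype.card X) ^ #U := fun W hW => by
    rw [prob_forall_comp_mem Subtype.val_injective, prod_const, card_univ, Fintype.card_coe]
    have hcard : #{x | E x ⊆ W} ≤ #W.powerset :=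
      card_le_card_of_injOn E (fun x hx => by simpa using hx) hE.injOn
    rw [card_powerset, (mem_powersetCard.1 hW).2] at hcard
    gcongr
    exact_mod_cast hcard
  calc prob (fun H : α → X => #(U.biUnion fun a => E (H a)) ≤ N)
      ≤ prob (fun H : α → X => ∃ W ∈ powersetCard N (univ : Finset V),
          ∀ c : U, H c ∈ ({x | E x ⊆ W} : Finset X)) := prob_mono fun H hH => by
        obtain ⟨W, hUW, hW⟩ := exists_superset_card_eq hH hN
        exact ⟨W, by simp [mem_powersetCard, hW], fun c => by
          simpa using (subset_biUnion_of_mem (fun a => E (H a)) c.2).trans hUW⟩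
    _ ≤ ∑ W ∈ powersetCard N (univ : Finset V),
          prob (fun H : α → X => ∀ c : U, H c ∈ ({x | E x ⊆ W} : Finset X)) :=
        prob_exists_le_sum _ _
    _ ≤ #(powersetCard N (univ : Finset V)) • (2 ^ N / Fintype.card X : ℝ) ^ #U :=
        sum_le_card_nsmul _ _ _ hinside
    _ ≤ (Fintype.card V : ℝ) ^ N * (2 ^ N / Fintype.card X) ^ #U := by
        rw [nsmul_eq_mul, card_powersetCard, card_univ]
        gcongr
        exact_mod_cast Nat.choose_le_pow _ _

variable [NeZero ℓ]

theorem sum_prob_isLooseCycleOn [Fact (1 < ℓ)] :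
    2 * (ℓ : ℝ) * ∑ A, prob (fun H : α → X => IsLooseCycleOn (fun a => E (H a)) ℓ A) =
      ∑ p : (ZMod ℓ → α) × (ZMod ℓ → V),
        prob fun H : α → X => IsCycleOrder (fun a => E (H a)) p.1 p.2 := by
  rw [sum_prob_eq_expect, sum_prob_eq_expect, mul_expect]
  refine expect_congr rfl fun H _ => ?_
  have hcard := card_isCycleOrder (ℓ := ℓ) fun a => E (H a)
  exact_mod_cast hcard.symm

theorem sum_prob_isBergeCycle [DecidableEq V] [Nonempty X] :
    ∑ p : (ZMod ℓ → α) × (ZMod ℓ → V),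
        prob (fun H : α → X => IsBergeCycle (fun a => E (H a)) p.1 p.2) =
      (Fintype.card α).descFactorial ℓ * ∑ v : ZMod ℓ → V with Function.Injective v,
        ∏ a, ((codegree E (v a) (v (a + 1)) : ℝ) / Fintype.card X) := by
  have hcard : #{e : ZMod ℓ → α | Function.Injective e} = (Fintype.card α).descFactorial ℓ := by
    rw [← Fintype.card_subtype, Fintype.card_congr (Equiv.subtypeInjectiveEquivEmbedding _ _),
      Fintype.card_embedding_eq, ZMod.card]
  rw [← hcard, ← nsmul_eq_mul, ← sum_const, ← sum_product']
  refine (sum_subset_zero_on_sdiff (subset_univ _) (fun p hp => ?_) fun p hp => ?_).symm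
  · have hnot : ∀ H : α → X, ¬ IsBergeCycle (fun a => E (H a)) p.1 p.2 := fun H h =>
      (mem_sdiff.1 hp).2 (by simp [h.edge_injective, h.vertex_injective])
    simp [prob, hnot]
  · simp only [mem_product, mem_filter_univ] at hp
    exact (prob_isBergeCycle hp.1 hp.2).symm

variable [Fact (1 < ℓ)] [Nonempty X]

theorem sum_prob_isBergeCycle_and_not_isCycleOrder_le
    (hE : Function.Injective E) (hk : ∀ x, #(E x) = k)
    (hkN : (k - 1) * ℓ = N + 1) (hN : N ≤ Fintype.card V)
    (e : ZMod ℓ → α) :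
    ∑ v : ZMod ℓ → V, prob (fun H : α → X => IsBergeCycle (fun a => E (H a)) e v ∧
        ¬ IsCycleOrder (fun a => E (H a)) e v) ≤
      k ^ ℓ * (Fintype.card V ^ N * (2 ^ N / Fintype.card X) ^ ℓ) := by
  classical
  by_cases he : Function.Injective e
  · have hcard : #(univ.image e) = ℓ := by rw [card_image_of_injective _ he, card_univ, ZMod.card]
    have hfew := prob_card_biUnion_le (α := α) hE (univ.image e) hN
    rw [hcard] at hfew
    refine (sum_prob_le_mul_prob (N := k ^ ℓ)
      (T := fun H : α → X => #((univ.image e).biUnion fun a => E (H a)) ≤ N)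
      (fun H s hs => ?_) fun v H hv => ?_).trans ?_
    · exact card_le_of_forall_isBergeCycle (fun a => hk (H a)) e s fun v hv => (hs v hv).1
    · have hlt := hv.1.card_biUnion_lt_of_not_isCycleOrder (fun a => hk (H a)) hv.2
      rw [hkN, Nat.lt_succ_iff] at hlt
      rwa [image_biUnion]
    · push_cast
      gcongr
  · have hnot : ∀ (v : ZMod ℓ → V) (H : α → X), ¬ IsBergeCycle (fun a => E (H a)) e v :=
      fun v H h => he h.edge_injective
    simp only [prob, hnot, false_and, if_false, expect_const_zero, sum_const_zero]
    positivity

theorem abs_sum_prob_isLooseCycleOn_sub_le [DecidableEq V]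
    (hE : Function.Injective E) (hk : ∀ x, #(E x) = k)
    (hkN : (k - 1) * ℓ = N + 1) (hN : N ≤ Fintype.card V) :
    |2 * (ℓ : ℝ) * ∑ A, prob (fun H : α → X => IsLooseCycleOn (fun a => E (H a)) ℓ A) -
      (Fintype.card α).descFactorial ℓ * ∑ v : ZMod ℓ → V with Function.Injective v,
        ∏ a, ((codegree E (v a) (v (a + 1)) : ℝ) / Fintype.card X)| ≤
      Fintype.card α ^ ℓ * (k ^ ℓ * (Fintype.card V ^ N * (2 ^ N / Fintype.card X) ^ ℓ)) := by
  rw [sum_prob_isLooseCycleOn, ← sum_prob_isBergeCycle, ← sum_sub_distrib]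
  calc |∑ p : (ZMod ℓ → α) × (ZMod ℓ → V),
        (prob (fun H : α → X => IsCycleOrder (fun a => E (H a)) p.1 p.2) -
          prob fun H : α → X => IsBergeCycle (fun a => E (H a)) p.1 p.2)|
      ≤ ∑ p : (ZMod ℓ → α) × (ZMod ℓ → V),
          prob fun H : α → X => IsBergeCycle (fun a => E (H a)) p.1 p.2 ∧
            ¬ IsCycleOrder (fun a => E (H a)) p.1 p.2 :=
        (abs_sum_le_sum_abs _ _).trans <| sum_le_sum fun p _ => abs_prob_sub_prob_le fun H hH =>
          ⟨IsCycleOrder.isBergeCycle, fun h => by_contra fun hne => hH ⟨h, hne⟩⟩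
    _ ≤ ∑ _e : ZMod ℓ → α, (k : ℝ) ^ ℓ * (Fintype.card V ^ N * (2 ^ N / Fintype.card X) ^ ℓ) := by
        rw [Fintype.sum_prod_type]
        exact sum_le_sum fun e _ =>
          sum_prob_isBergeCycle_and_not_isCycleOrder_le hE hk hkN hN e
    _ = _ := by
        rw [sum_const, card_univ, Fintype.card_fun, ZMod.card, nsmul_eq_mul]
        push_cast
        rfl

end RandomFamily

section SupportPairs

/-- The sets of edge labels that can carry one of the cycles to be counted: those of size at
least `2` and at most `L`. -/
abbrev CycleSupport (α : Type*) (L : ℕ) : Type _ := {A : Finset α // #A ∈ Icc 2 L}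

namespace CycleSupport

variable {α : Type*} {L : ℕ}

/-- The length of a cycle with the edge set `A`, as an element of the index set of the lengths. -/
def length (A : CycleSupport α L) : Icc 2 L := ⟨#A.1, A.2⟩

instance (A : CycleSupport α L) : NeZero #A.1 := ⟨by have := mem_Icc.1 A.2; omega⟩

instance (A : CycleSupport α L) : Fact (1 < #A.1) := ⟨(mem_Icc.1 A.2).1⟩

theorem card_union_le [DecidableEq α] (A B : CycleSupport α L) : #(A.1 ∪ B.1) ≤ 2 * L := by
  have hA := mem_Icc.1 A.2
  have hB := mem_Icc.1 B.2
  have := Finset.card_union_le A.1 B.1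
  omega

variable [Fintype α] [DecidableEq α]

/-- The dependence neighbourhood of `A`: the supports that share an edge with `A`. -/
def neighbours (A : CycleSupport α L) : Finset (CycleSupport α L) := {B | ¬ Disjoint A.1 B.1}

theorem mem_neighbours {A B : CycleSupport α L} : B ∈ A.neighbours ↔ ¬ Disjoint A.1 B.1 :=
  mem_filter_univ B

theorem self_mem_neighbours (A : CycleSupport α L) : A ∈ A.neighbours := by
  rw [mem_neighbours, disjoint_self_iff_empty, ← card_eq_zero]
  exact NeZero.ne _

theorem card_union_lt_of_mem_neighbours {A B : CycleSupport α L} (hB : B ∈ A.neighbours) :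
    #(A.1 ∪ B.1) < #A.1 + #B.1 := by
  rw [← card_union_add_card_inter]
  exact Nat.lt_add_of_pos_right (card_pos.2 (not_disjoint_iff_nonempty_inter.1
    (mem_neighbours.1 hB)))

end CycleSupport

variable {α : Type*} [Fintype α] [DecidableEq α]

theorem card_filter_card_union_eq_le (t : ℕ) :
    #{p : Finset α × Finset α | #(p.1 ∪ p.2) = t} ≤ (4 * Fintype.card α) ^ t := by
  have hsub : ({p | #(p.1 ∪ p.2) = t} : Finset (Finset α × Finset α)) ⊆
      (powersetCard t univ).biUnion fun U => U.powerset ×ˢ U.powerset := fun p hp =>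
    mem_biUnion.2 ⟨p.1 ∪ p.2, mem_powersetCard.2 ⟨subset_univ _, (mem_filter_univ p).1 hp⟩,
      mem_product.2 ⟨mem_powerset.2 subset_union_left, mem_powerset.2 subset_union_right⟩⟩
  calc #{p : Finset α × Finset α | #(p.1 ∪ p.2) = t}
      ≤ #(powersetCard t (univ : Finset α)) * 4 ^ t :=
        (card_le_card hsub).trans <| card_biUnion_le_card_mul _ _ _ fun U hU => by
          rw [card_product, card_powerset, (mem_powersetCard.1 hU).2, ← mul_pow]
          rfl
    _ ≤ Fintype.card α ^ t * 4 ^ t := by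
        rw [card_powersetCard, card_univ]
        exact Nat.mul_le_mul_right _ (Nat.choose_le_pow _ _)
    _ = (4 * Fintype.card α) ^ t := by rw [mul_pow, mul_comm]

theorem sum_card_union_le {R : ℕ} {g : ℕ → ℝ} (hg : ∀ t, 0 ≤ g t)
    {s : Finset (Finset α × Finset α)} (hs : ∀ p ∈ s, #(p.1 ∪ p.2) ≤ R) :
    ∑ p ∈ s, g #(p.1 ∪ p.2) ≤ ∑ t ∈ range (R + 1), (4 * Fintype.card α) ^ t * g t := by
  have hmaps : ∀ p ∈ s, #(p.1 ∪ p.2) ∈ range (R + 1) := fun p hp =>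
    mem_range_succ_iff.2 (hs p hp)
  rw [← sum_fiberwise_of_maps_to hmaps]
  refine sum_le_sum fun t _ => ?_
  have hcard : #{p ∈ s | #(p.1 ∪ p.2) = t} ≤ (4 * Fintype.card α) ^ t :=
    (card_le_card (filter_subset_filter _ (subset_univ s))).trans (card_filter_card_union_eq_le t)
  rw [sum_congr rfl fun p hp => congrArg g (mem_filter.1 hp).2, sum_const, nsmul_eq_mul]
  exact mul_le_mul_of_nonneg_right (by exact_mod_cast hcard) (hg t)

end SupportPairs

section DependenceError

variable {α V X : Type*} {E : X → Finset V} {k L R N r : ℕ} {φ : ℝ}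

/-- The event that the edges of the random family `H` with labels in `A` form a loose cycle. -/
def IsCycleAt (E : X → Finset V) (A : Finset α) (H : α → X) : Prop :=
  IsLooseCycleOn (fun a => E (H a)) #A A

/-- The constant in the bounds for the probability that at most `R` edges span few vertices, where
`φ` bounds from below the proportion of the edges among the `k`-tuples of vertices. -/
noncomputable def spanConst (k R : ℕ) (φ : ℝ) : ℝ := (2 ^ (k * R) / φ) ^ R

theorem spanConst_pos (hφ : 0 < φ) : 0 < spanConst k R φ := by
  unfold spanConst
  positivity

theorem dependsOn_isCycleAt (A : Finset α) : DependsOn (IsCycleAt E A) (A : Set α) :=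
  fun _ _ h => propext
    ⟨IsLooseCycleOn.congr fun a ha => congrArg E (h a ha),
      IsLooseCycleOn.congr fun a ha => congrArg E (h a ha).symm⟩

variable [Fintype α] [DecidableEq α] [Fintype X]

theorem prob_isCycleAt_and_typeCount {J : Type*} (κ : CycleSupport α L → J)
    (A : CycleSupport α L) (y : J → ℕ) :
    prob (fun H : α → X => IsCycleAt E A.1 H ∧
        typeCount κ (fun B : CycleSupport α L => IsCycleAt E B.1) A.neighboursᶜ H = y) =
      prob (IsCycleAt E A.1) * prob fun H : α → X =>
        typeCount κ (fun B : CycleSupport α L => IsCycleAt E B.1) A.neighboursᶜ H = y := by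
  classical
  refine prob_and_eq_mul_of_dependsOn (dependsOn_isCycleAt A.1) fun H H' h => ?_
  suffices hcount : typeCount κ (fun B : CycleSupport α L => IsCycleAt E B.1) A.neighboursᶜ H =
      typeCount κ (fun B : CycleSupport α L => IsCycleAt E B.1) A.neighboursᶜ H' by rw [hcount]
  funext j
  rw [typeCount_eq_card, typeCount_eq_card]
  refine congrArg card (filter_congr fun B hB => and_congr_right fun _ => ?_)
  rw [mem_compl, CycleSupport.mem_neighbours, not_not] at hB
  exact iff_of_eq (dependsOn_isCycleAt B.1 fun a ha => h a (disjoint_right.1 hB ha))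

variable [Fintype V]

/-- `E` enumerates different `k`-sets of vertices without repetition, and their number is at least
the proportion `φ > 0` of the number of `k`-tuples of vertices. -/
structure IsDenseFamily (E : X → Finset V) (k : ℕ) (φ : ℝ) : Prop where
  injective : Function.Injective E
  card_eq : ∀ x, #(E x) = k
  pos : 0 < φ
  mul_pow_le : φ * (Fintype.card V : ℝ) ^ k ≤ Fintype.card X

variable [Nonempty V]

theorem IsDenseFamily.le_one (h : IsDenseFamily E k φ) : φ ≤ 1 := by
  have hcard : Fintype.card X ≤ #(powersetCard k (univ : Finset V)) :=
    card_le_card_of_injOn E (fun x _ => mem_powersetCard.2 ⟨subset_univ _, h.card_eq x⟩)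
      h.injective.injOn
  rw [card_powersetCard, card_univ] at hcard
  have hle : φ * (Fintype.card V : ℝ) ^ k ≤ 1 * (Fintype.card V : ℝ) ^ k := by
    rw [one_mul]
    exact h.mul_pow_le.trans (by exact_mod_cast hcard.trans (Nat.choose_le_pow _ _))
  exact le_of_mul_le_mul_right hle (pow_pos (by exact_mod_cast Fintype.card_pos) k)

theorem IsDenseFamily.nonempty (h : IsDenseFamily E k φ) : Nonempty X := by
  have hV : (0 : ℝ) < Fintype.card V := by exact_mod_cast Fintype.card_pos
  have hX : (0 : ℝ) < Fintype.card X := (mul_pos h.pos (pow_pos hV k)).trans_le h.mul_pow_le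
  exact Fintype.card_pos_iff.1 (by exact_mod_cast hX)

theorem prob_card_biUnion_le_div [DecidableEq V] (h : IsDenseFamily E k φ)
    (hV : k * R ≤ Fintype.card V) {U : Finset α} (hU : #U ≤ R) (hN : N + r = k * #U) :
    prob (fun H : α → X => #(U.biUnion fun a => E (H a)) ≤ N) ≤
      spanConst k R φ / (Fintype.card V : ℝ) ^ r := by
  have hφ := h.pos
  have hX := h.mul_pow_le
  have := h.nonempty
  have hNR : N ≤ k * R := (Nat.le_add_right N r).trans (hN.le.trans (Nat.mul_le_mul_left k hU))
  have hbase : (1 : ℝ) ≤ 2 ^ (k * R) / φ :=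
    (one_le_div hφ).2 (h.le_one.trans (one_le_pow₀ one_le_two))
  calc prob (fun H : α → X => #(U.biUnion fun a => E (H a)) ≤ N)
      ≤ (Fintype.card V : ℝ) ^ N * (2 ^ N / Fintype.card X) ^ #U :=
        prob_card_biUnion_le h.injective U (hNR.trans hV)
    _ ≤ (Fintype.card V : ℝ) ^ N * (2 ^ (k * R) / (φ * (Fintype.card V : ℝ) ^ k)) ^ #U := by
        gcongr
        exact one_le_two
    _ = (2 ^ (k * R) / φ) ^ #U / (Fintype.card V : ℝ) ^ r := by
        rw [← div_div, div_pow _ ((Fintype.card V : ℝ) ^ k), ← pow_mul, ← hN, pow_add]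
        field_simp
    _ ≤ spanConst k R φ / (Fintype.card V : ℝ) ^ r := by
        unfold spanConst
        gcongr

variable {A B : CycleSupport α L}

theorem prob_isCycleAt_le (h : IsDenseFamily E k φ) (hV : k * (2 * L) ≤ Fintype.card V)
    (hk : 0 < k) :
    prob (IsCycleAt E A.1) ≤ spanConst k (2 * L) φ / (Fintype.card V : ℝ) ^ #A.1 := by
  classical
  refine (prob_mono fun H hH => ?_).trans (prob_card_biUnion_le_div (U := A.1)
    (N := (k - 1) * #A.1) h hV ?_ ?_)
  · exact hH.card_biUnion_le fun a => h.card_eq (H a)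
  · have := mem_Icc.1 A.2
    omega
  · rw [← Nat.succ_mul, Nat.succ_eq_add_one, Nat.sub_add_cancel hk]

theorem prob_isCycleAt_and_isCycleAt_le (h : IsDenseFamily E k φ)
    (hV : k * (2 * L) ≤ Fintype.card V) (hk : 1 < k) (hne : A ≠ B) (hB : B ∈ A.neighbours) :
    prob (fun H => IsCycleAt E A.1 H ∧ IsCycleAt E B.1 H) ≤
      spanConst k (2 * L) φ / (Fintype.card V : ℝ) ^ (#(A.1 ∪ B.1) + 1) := by
  classical
  refine (prob_mono fun H hH => ?_).trans (prob_card_biUnion_le_div (U := A.1 ∪ B.1)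
    (N := (k - 1) * #(A.1 ∪ B.1) - 1) h hV (A.card_union_le B) ?_)
  · exact Nat.le_sub_one_of_lt (hH.1.card_biUnion_union_lt hH.2 (fun a => h.card_eq (H a))
      (Subtype.coe_injective.ne hne) (CycleSupport.mem_neighbours.1 hB))
  · have hpos : 0 < (k - 1) * #(A.1 ∪ B.1) := Nat.mul_pos (by omega)
      ((NeZero.pos #A.1).trans_le (card_le_card subset_union_left))
    obtain ⟨s, rfl⟩ : ∃ s, k = s + 1 := ⟨k - 1, by omega⟩
    rw [Nat.add_sub_cancel] at hpos ⊢
    rw [Nat.succ_mul]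
    omega

theorem prob_isCycleAt_mul_le (h : IsDenseFamily E k φ) (hV : k * (2 * L) ≤ Fintype.card V)
    (hk : 0 < k) (hB : B ∈ A.neighbours) :
    prob (IsCycleAt E A.1) * prob (IsCycleAt E B.1) ≤
      spanConst k (2 * L) φ ^ 2 / (Fintype.card V : ℝ) ^ (#(A.1 ∪ B.1) + 1) := by
  have hn : (1 : ℝ) ≤ Fintype.card V := by exact_mod_cast Fintype.card_pos
  have hC := spanConst_pos (k := k) (R := 2 * L) h.pos
  calc prob (IsCycleAt E A.1) * prob (IsCycleAt E B.1)
      ≤ (spanConst k (2 * L) φ / (Fintype.card V : ℝ) ^ #A.1) *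
          (spanConst k (2 * L) φ / (Fintype.card V : ℝ) ^ #B.1) :=
        mul_le_mul (prob_isCycleAt_le h hV hk) (prob_isCycleAt_le h hV hk) prob_nonneg
          (by positivity)
    _ = spanConst k (2 * L) φ ^ 2 / (Fintype.card V : ℝ) ^ (#A.1 + #B.1) := by
        rw [div_mul_div_comm, pow_add, sq]
    _ ≤ _ := by
        have hlt := CycleSupport.card_union_lt_of_mem_neighbours hB
        exact div_le_div_of_nonneg_left (by positivity) (by positivity) (pow_le_pow_right₀ hn hlt)

theorem dependenceError_isCycleAt_le (h : IsDenseFamily E k φ)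
    (hV : k * (2 * L) ≤ Fintype.card V) (hk : 1 < k) :
    dependenceError (fun A : CycleSupport α L => IsCycleAt E A.1) CycleSupport.neighbours ≤
      (Fintype.card V : ℝ)⁻¹ * ∑ t ∈ range (2 * L + 1),
        (spanConst k (2 * L) φ + spanConst k (2 * L) φ ^ 2) *
          (4 * (Fintype.card α / Fintype.card V)) ^ t := by
  set C := spanConst k (2 * L) φ
  have hC : 0 < C := spanConst_pos h.pos
  set n : ℝ := (Fintype.card V : ℝ)
  have hn : 0 < n := Nat.cast_pos.2 Fintype.card_pos
  calc dependenceError (fun A : CycleSupport α L => IsCycleAt E A.1) CycleSupport.neighbours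
      ≤ ∑ A : CycleSupport α L, ∑ B : CycleSupport α L,
          (C + C ^ 2) / n ^ (#(A.1 ∪ B.1) + 1) := sum_le_sum fun A _ => by
        simp_rw [add_div, sum_add_distrib]
        refine add_le_add
          ((sum_le_sum fun B hB => ?_).trans (sum_le_univ_sum_of_nonneg fun B => by positivity))
          ((sum_le_sum fun B hB => ?_).trans (sum_le_univ_sum_of_nonneg fun B => by positivity))
        · exact prob_isCycleAt_and_isCycleAt_le h hV hk (ne_of_mem_erase hB).symm
            (mem_of_mem_erase hB)
        · exact prob_isCycleAt_mul_le h hV (by omega) hB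
    _ = ∑ p ∈ (univ : Finset (CycleSupport α L × CycleSupport α L)).map
          ((Function.Embedding.subtype _).prodMap (Function.Embedding.subtype _)),
          (C + C ^ 2) / n ^ (#(p.1 ∪ p.2) + 1) := by
        rw [sum_map, Fintype.sum_prod_type]
        rfl
    _ ≤ ∑ t ∈ range (2 * L + 1), (4 * Fintype.card α) ^ t * ((C + C ^ 2) / n ^ (t + 1)) := by
        refine sum_card_union_le (g := fun t => (C + C ^ 2) / n ^ (t + 1))
          (fun t => by positivity) fun p hp => ?_
        obtain ⟨⟨A, B⟩, -, rfl⟩ := mem_map.1 hp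
        exact CycleSupport.card_union_le A B
    _ = _ := by
        rw [mul_sum]
        refine sum_congr rfl fun t _ => ?_
        rw [mul_pow, mul_pow, div_pow, pow_succ]
        field_simp
        ring

end DependenceError

section Asymptotics

variable {ι : Type*} {l : Filter ι} {N a : ι → ℕ} {ρ : ℝ}

theorem tendsto_tsub_div (hN : Tendsto N l atTop)
    (ha : Tendsto (fun i => (a i : ℝ) / N i) l (𝓝 ρ)) (s : ℕ) :
    Tendsto (fun i => ((a i - s : ℕ) : ℝ) / N i) l (𝓝 ρ) := by
  have hNr : Tendsto (fun i => (N i : ℝ)) l atTop := tendsto_natCast_atTop_atTop.comp hN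
  have hlow : Tendsto (fun i => (a i : ℝ) / N i - s / N i) l (𝓝 ρ) := by
    simpa using ha.sub (hNr.const_div_atTop (s : ℝ))
  refine tendsto_of_tendsto_of_tendsto_of_le_of_le hlow ha (fun i => ?_) fun i => ?_
  · dsimp only
    rw [← sub_div]
    gcongr
    rw [sub_le_iff_le_add]
    exact_mod_cast le_tsub_add
  · dsimp only
    gcongr
    exact Nat.sub_le _ _

theorem tendsto_descFactorial_div (hN : Tendsto N l atTop)
    (ha : Tendsto (fun i => (a i : ℝ) / N i) l (𝓝 ρ)) (r : ℕ) :
    Tendsto (fun i => ((a i).descFactorial r : ℝ) / (N i : ℝ) ^ r) l (𝓝 (ρ ^ r)) := by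
  induction r with
  | zero => simpa using tendsto_const_nhds
  | succ r ih =>
    rw [pow_succ']
    refine ((tendsto_tsub_div hN ha r).mul ih).congr fun i => ?_
    rw [Nat.descFactorial_succ, pow_succ', div_mul_div_comm]
    push_cast
    rfl

theorem tendsto_choose_div (hN : Tendsto N l atTop)
    (ha : Tendsto (fun i => (a i : ℝ) / N i) l (𝓝 ρ)) (r : ℕ) :
    Tendsto (fun i => ((a i).choose r : ℝ) / (N i : ℝ) ^ r) l (𝓝 (ρ ^ r / r.factorial)) := by
  refine ((tendsto_descFactorial_div hN ha r).div_const (r.factorial : ℝ)).congr fun i => ?_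
  rw [Nat.descFactorial_eq_factorial_mul_choose]
  have hfac : (r.factorial : ℝ) ≠ 0 := by exact_mod_cast r.factorial_ne_zero
  push_cast
  field_simp

end Asymptotics

section CycleCounts

variable {ι : Type*} {l : Filter ι} {k ℓ : ℕ} {N m : ι → ℕ} {X : ι → Type*} [∀ i, Fintype (X i)]
  {E : ∀ i, X i → Finset (Fin (N i))} {c φ τ : ℝ}

theorem eventually_isDenseFamily (hE : ∀ i, Function.Injective (E i)) (hk : ∀ i x, #(E i x) = k)
    (hφ : 0 < φ)
    (hX : Tendsto (fun i => (Fintype.card (X i) : ℝ) / (N i : ℝ) ^ k) l (𝓝 φ)) :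
    ∀ᶠ i in l, IsDenseFamily (E i) k (φ / 2) := by
  filter_upwards [hX.eventually_const_lt (half_lt_self hφ)] with i hi
  have hpos : (0 : ℝ) < (N i : ℝ) ^ k := by
    refine (pow_nonneg (Nat.cast_nonneg _) k).lt_of_ne fun h0 => ?_
    rw [← h0, div_zero] at hi
    linarith
  refine ⟨hE i, hk i, half_pos hφ, ?_⟩
  rw [Fintype.card_fin]
  exact (lt_div_iff₀ hpos).1 hi |>.le

/-- The number of ways to choose `ℓ` distinct vertices in cyclic order together with an edge
through every two consecutive ones. -/
noncomputable def cycleWeight {X V : Type*} [Fintype X] [Fintype V] [DecidableEq V]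
    (E : X → Finset V) (ℓ : ℕ) [NeZero ℓ] : ℝ :=
  ∑ v : ZMod ℓ → V with Function.Injective v, ∏ a, (codegree E (v a) (v (a + 1)) : ℝ)

theorem tendsto_pow_mul_pow_div_card_pow {M : ℕ} (hkM : k * ℓ = M + (ℓ + 1))
    (hN : Tendsto N l atTop) (hm : Tendsto (fun i => (m i : ℝ) / N i) l (𝓝 c)) (hφ : φ ≠ 0)
    (hX : Tendsto (fun i => (Fintype.card (X i) : ℝ) / (N i : ℝ) ^ k) l (𝓝 φ)) :
    Tendsto (fun i => (m i : ℝ) ^ ℓ * (N i : ℝ) ^ M / (Fintype.card (X i) : ℝ) ^ ℓ) l (𝓝 0) := by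
  have hNr : Tendsto (fun i => (N i : ℝ)) l atTop := tendsto_natCast_atTop_atTop.comp hN
  have hlim := ((hm.pow ℓ).div (hX.pow ℓ) (pow_ne_zero ℓ hφ)).mul hNr.inv_tendsto_atTop
  rw [mul_zero] at hlim
  refine hlim.congr' ?_
  filter_upwards [hN.eventually_ne_atTop 0] with i hi
  rw [Pi.div_apply, Pi.inv_apply, div_pow, div_pow, ← pow_mul, hkM]
  field_simp
  ring

variable [NeZero ℓ]

theorem tendsto_descFactorial_mul_sum_prod_codegree (hN : Tendsto N l atTop)
    (hm : Tendsto (fun i => (m i : ℝ) / N i) l (𝓝 c)) (hφ : φ ≠ 0)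
    (hX : Tendsto (fun i => (Fintype.card (X i) : ℝ) / (N i : ℝ) ^ k) l (𝓝 φ)) (hk : 0 < k)
    (hτ : Tendsto (fun i => cycleWeight (E i) ℓ / (N i : ℝ) ^ ((k - 1) * ℓ)) l (𝓝 τ)) :
    Tendsto (fun i => ((m i).descFactorial ℓ : ℝ) *
      ∑ v : ZMod ℓ → Fin (N i) with Function.Injective v,
        ∏ a, ((codegree (E i) (v a) (v (a + 1)) : ℝ) / Fintype.card (X i))) l
      (𝓝 ((c / φ) ^ ℓ * τ)) := by
  have hlim := ((tendsto_descFactorial_div hN hm ℓ).div (hX.pow ℓ) (pow_ne_zero ℓ hφ)).mul hτ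
  rw [← div_pow] at hlim
  refine hlim.congr' ?_
  filter_upwards [hN.eventually_ne_atTop 0] with i hi
  have hexp : (N i : ℝ) ^ (k * ℓ) = (N i : ℝ) ^ ((k - 1) * ℓ) * (N i : ℝ) ^ ℓ := by
    rw [← pow_add, ← Nat.succ_mul, Nat.succ_eq_add_one, Nat.sub_add_cancel hk]
  simp_rw [prod_div_distrib, prod_const, card_univ, ZMod.card]
  rw [← sum_div, Pi.div_apply, div_pow _ ((N i : ℝ) ^ k), ← pow_mul, hexp, cycleWeight]
  field_simp

theorem tendsto_sum_prob_isLooseCycleOn [Fact (1 < ℓ)]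
    (hE : ∀ i, Function.Injective (E i)) (hk : ∀ i x, #(E i x) = k) (hk1 : 1 < k)
    (hN : Tendsto N l atTop) (hm : Tendsto (fun i => (m i : ℝ) / N i) l (𝓝 c)) (hφ : 0 < φ)
    (hX : Tendsto (fun i => (Fintype.card (X i) : ℝ) / (N i : ℝ) ^ k) l (𝓝 φ))
    (hτ : Tendsto (fun i => cycleWeight (E i) ℓ / (N i : ℝ) ^ ((k - 1) * ℓ)) l (𝓝 τ)) :
    Tendsto (fun i => ∑ A, prob fun H : Fin (m i) → X i =>
      IsLooseCycleOn (fun a => E i (H a)) ℓ A) l (𝓝 ((c / φ) ^ ℓ * τ / (2 * ℓ))) := by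
  obtain ⟨M, hM⟩ : ∃ M, (k - 1) * ℓ = M + 1 :=
    Nat.exists_eq_succ_of_ne_zero (Nat.mul_pos (by omega) (NeZero.pos ℓ)).ne'
  have hkM : k * ℓ = M + (ℓ + 1) := by
    obtain ⟨s, rfl⟩ : ∃ s, k = s + 1 := ⟨k - 1, by omega⟩
    rw [Nat.add_sub_cancel] at hM
    rw [Nat.succ_mul]
    omega
  have hmain := tendsto_descFactorial_mul_sum_prod_codegree hN hm hφ.ne' hX (by omega) hτ
  have herror := (tendsto_pow_mul_pow_div_card_pow hkM hN hm hφ.ne' hX).const_mul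
    ((k : ℝ) ^ ℓ * (2 ^ M) ^ ℓ)
  rw [mul_zero] at herror
  have hdiff := squeeze_zero_norm' (f := fun i => 2 * (ℓ : ℝ) *
    ∑ A, prob (fun H : Fin (m i) → X i => IsLooseCycleOn (fun a => E i (H a)) ℓ A) -
      (m i).descFactorial ℓ * ∑ v : ZMod ℓ → Fin (N i) with Function.Injective v,
        ∏ a, ((codegree (E i) (v a) (v (a + 1)) : ℝ) / Fintype.card (X i))) ?_ herror
  · have hlim := (hdiff.add hmain).div_const (2 * (ℓ : ℝ))
    rw [zero_add] at hlim
    refine hlim.congr fun i => ?_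
    rw [sub_add_cancel, mul_div_cancel_left₀]
    exact mul_ne_zero two_ne_zero (Nat.cast_ne_zero.2 (NeZero.ne ℓ))
  · filter_upwards [eventually_isDenseFamily hE hk hφ hX, hN.eventually_ge_atTop M,
      hN.eventually_gt_atTop 0] with i hdense hi hi0
    have : NeZero (N i) := ⟨hi0.ne'⟩
    have := hdense.nonempty
    have hbound := abs_sum_prob_isLooseCycleOn_sub_le (α := Fin (m i)) (hE i) (hk i) hM
      (by rwa [Fintype.card_fin])
    simp only [Fintype.card_fin] at hbound
    refine hbound.trans (le_of_eq ?_)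
    rw [div_pow]
    ring

theorem tendsto_dependenceError_isCycleAt (L : ℕ) (hE : ∀ i, Function.Injective (E i))
    (hk : ∀ i x, #(E i x) = k) (hk1 : 1 < k)
    (hN : Tendsto N l atTop) (hm : Tendsto (fun i => (m i : ℝ) / N i) l (𝓝 c)) (hφ : 0 < φ)
    (hX : Tendsto (fun i => (Fintype.card (X i) : ℝ) / (N i : ℝ) ^ k) l (𝓝 φ)) :
    Tendsto (fun i => dependenceError
      (fun (A : CycleSupport (Fin (m i)) L) (H : Fin (m i) → X i) => IsCycleAt (E i) A.1 H)
      CycleSupport.neighbours) l (𝓝 0) := by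
  have hNr : Tendsto (fun i => (N i : ℝ)) l atTop := tendsto_natCast_atTop_atTop.comp hN
  have hbound := hNr.inv_tendsto_atTop.mul <| tendsto_finsetSum (range (2 * L + 1)) fun t _ =>
    ((hm.const_mul 4).pow t).const_mul
      (spanConst k (2 * L) (φ / 2) + spanConst k (2 * L) (φ / 2) ^ 2)
  rw [zero_mul] at hbound
  refine squeeze_zero' (.of_forall fun i => ?_) ?_ hbound
  · exact sum_nonneg fun A _ => add_nonneg (sum_nonneg fun _ _ => prob_nonneg)
      (sum_nonneg fun _ _ => mul_nonneg prob_nonneg prob_nonneg)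
  filter_upwards [eventually_isDenseFamily hE hk hφ hX, hN.eventually_ge_atTop (k * (2 * L)),
    hN.eventually_gt_atTop 0] with i hdense hi hi0
  have : NeZero (N i) := ⟨hi0.ne'⟩
  have hle := dependenceError_isCycleAt_le (α := Fin (m i)) hdense (by rwa [Fintype.card_fin]) hk1
  simp only [Fintype.card_fin] at hle
  exact hle

section

variable {α V X : Type*} [Fintype α] {E : X → Finset V} {L : ℕ}

open Classical in
theorem typeCount_length_eq (H : α → X) (j : Icc 2 L) :
    typeCount CycleSupport.length (fun A : CycleSupport α L => IsCycleAt E A.1) univ H j =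
      #{A : Finset α | IsLooseCycleOn (fun a => E (H a)) j A} := by
  have hj := mem_Icc.1 j.2
  have : NeZero j.1 := ⟨by omega⟩
  rw [typeCount_eq_card]
  refine card_bij (fun A _ => A.1) (fun A hA => ?_) (fun A _ B _ => Subtype.ext) fun A hA => ?_
  · obtain ⟨hlen, hcycle⟩ := (mem_filter_univ A).1 hA
    rw [mem_filter_univ, ← hlen]
    exact hcycle
  · have hcycle := (mem_filter_univ A).1 hA
    have hcard := hcycle.card_eq
    refine ⟨⟨A, hcard ▸ j.2⟩, (mem_filter_univ _).2 ⟨Subtype.ext hcard, ?_⟩, rfl⟩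
    rwa [← hcard] at hcycle

theorem sum_prob_isCycleAt_eq [DecidableEq α] [Fintype X] (j : Icc 2 L) :
    ∑ A : CycleSupport α L with A.length = j, prob (fun H : α → X => IsCycleAt E A.1 H) =
      ∑ A, prob fun H : α → X => IsLooseCycleOn (fun a => E (H a)) j A := by
  classical
  rw [sum_prob_eq_expect, sum_prob_eq_expect]
  refine expect_congr rfl fun H _ => ?_
  rw [filter_filter, ← typeCount_eq_card, typeCount_length_eq]

end

open Classical in
theorem tendsto_prob_card_isLooseCycleOn {L : ℕ} {τ : ℕ → ℝ}
    (hE : ∀ i, Function.Injective (E i)) (hk : ∀ i x, #(E i x) = k) (hk1 : 1 < k)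
    (hN : Tendsto N l atTop) (hm : Tendsto (fun i => (m i : ℝ) / N i) l (𝓝 c)) (hφ : 0 < φ)
    (hX : Tendsto (fun i => (Fintype.card (X i) : ℝ) / (N i : ℝ) ^ k) l (𝓝 φ))
    (hτ : ∀ (ℓ : ℕ) [NeZero ℓ], 2 ≤ ℓ → ℓ ≤ L →
      Tendsto (fun i => cycleWeight (E i) ℓ / (N i : ℝ) ^ ((k - 1) * ℓ)) l (𝓝 (τ ℓ)))
    (x : ℕ → ℕ) :
    Tendsto (fun i => prob fun H : Fin (m i) → X i => ∀ ℓ, 2 ≤ ℓ → ℓ ≤ L →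
      #{A : Finset (Fin (m i)) | IsLooseCycleOn (fun a => E i (H a)) ℓ A} = x ℓ) l
      (𝓝 (∏ ℓ ∈ Icc 2 L, poissonProb ((c / φ) ^ ℓ * τ ℓ / (2 * ℓ)) (x ℓ))) := by
  have hnonempty : ∀ᶠ i in l, Nonempty (Fin (m i) → X i) := by
    filter_upwards [eventually_isDenseFamily hE hk hφ hX, hN.eventually_gt_atTop 0] with i hi hi0
    have : NeZero (N i) := ⟨hi0.ne'⟩
    have := hi.nonempty
    infer_instance
  have hlim := tendsto_prob_typeCount (κ := fun i => CycleSupport.length (α := Fin (m i)))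
    (I := fun i (A : CycleSupport (Fin (m i)) L) (H : Fin (m i) → X i) => IsCycleAt (E i) A.1 H)
    (μ := fun j : Icc 2 L => (c / φ) ^ (j : ℕ) * τ j / (2 * (j : ℕ)))
    hnonempty (fun i A => A.self_mem_neighbours)
    (fun i A y => prob_isCycleAt_and_typeCount _ A y)
    (tendsto_dependenceError_isCycleAt L hE hk hk1 hN hm hφ hX) (fun j => ?_) fun j => x j
  · rw [prod_coe_sort (Icc 2 L) fun ℓ => poissonProb ((c / φ) ^ ℓ * τ ℓ / (2 * ℓ)) (x ℓ)] at hlim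
    refine hlim.congr fun i => prob_congr fun H => ?_
    simp only [funext_iff, typeCount_length_eq, Subtype.forall, mem_Icc, and_imp]
  · have hj := mem_Icc.1 j.2
    have : NeZero j.1 := ⟨by omega⟩
    have : Fact (1 < j.1) := ⟨hj.1⟩
    simp_rw [sum_prob_isCycleAt_eq]
    exact tendsto_sum_prob_isLooseCycleOn hE hk hk1 hN hm hφ hX (hτ j hj.1 hj.2)

end CycleCounts

section ClosedWalks

variable {Q : Type*} [Fintype Q] {ℓ : ℕ}

theorem sum_prod_path_mul (M : Matrix Q Q ℝ) [DecidableEq Q] (n : ℕ) (g : Q → Q → ℝ) :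
    ∑ s : Fin (n + 1) → Q, (∏ a : Fin n, M (s a.castSucc) (s a.succ)) * g (s 0) (s (Fin.last n)) =
      ∑ i, ∑ j, (M ^ n) i j * g i j := by
  induction n generalizing g with
  | zero =>
    rw [← (Equiv.funUnique (Fin 1) Q).symm.sum_comp]
    simp [Matrix.one_apply]
  | succ n ih =>
    rw [← (Fin.consEquiv fun _ => Q).sum_comp, Fintype.sum_prod_type]
    refine sum_congr rfl fun i _ => ?_
    calc _ = ∑ s : Fin (n + 1) → Q, (∏ a : Fin n, M (s a.castSucc) (s a.succ)) *
          (M i (s 0) * g i (s (Fin.last n))) := by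
          refine sum_congr rfl fun s _ => ?_
          rw [Fin.prod_univ_succ]
          simp only [Fin.consEquiv_apply, Fin.castSucc_zero, Fin.cons_zero, Fin.cons_succ,
            ← Fin.succ_castSucc, ← Fin.succ_last]
          ring
      _ = ∑ j, ∑ i', (M ^ n) i' j * (M i i' * g i j) := by
          rw [ih fun i' j => M i i' * g i j, sum_comm]
      _ = ∑ j, (M ^ (n + 1)) i j * g i j := by
          refine sum_congr rfl fun j _ => ?_
          rw [pow_succ', Matrix.mul_apply, sum_mul]
          exact sum_congr rfl fun i' _ => by ring

theorem sum_prod_cyclic_eq_trace_pow [DecidableEq Q] [NeZero ℓ] (M : Matrix Q Q ℝ) :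
    ∑ s : ZMod ℓ → Q, ∏ a, M (s a) (s (a + 1)) = (M ^ ℓ).trace := by
  obtain ⟨n, rfl⟩ : ∃ n, ℓ = n + 1 := Nat.exists_eq_succ_of_ne_zero (NeZero.ne ℓ)
  change ∑ s : Fin (n + 1) → Q, ∏ a, M (s a) (s (a + 1)) = (M ^ (n + 1)).trace
  simp only [Matrix.trace, pow_succ, Matrix.diag_apply, Matrix.mul_apply]
  rw [← sum_prod_path_mul M n fun i j => M j i]
  refine sum_congr rfl fun s _ => ?_
  simp [Fin.prod_univ_castSucc]

theorem smul_add_smul_one_sub_pow {R A : Type*} [CommSemiring R] [Ring A] [Algebra R A] {P : A}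
    (hP : IsIdempotentElem P) (a b : R) (n : ℕ) :
    (a • P + b • (1 - P)) ^ n = a ^ n • P + b ^ n • (1 - P) := by
  induction n with
  | zero => simp
  | succ n ih =>
    rw [pow_succ, ih, add_mul, mul_add, mul_add]
    simp only [smul_mul_smul_comm, hP.mul_one_sub_self, hP.one_sub_mul_self, hP.one_sub.eq, hP.eq,
      smul_zero, add_zero, zero_add, pow_succ]

theorem sum_prod_cyclic_ite [DecidableEq Q] [Nonempty Q] [NeZero ℓ] (a b : ℝ) :
    ∑ s : ZMod ℓ → Q, ∏ t, (if s t = s (t + 1) then a else b) =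
      (a + (Fintype.card Q - 1) * b) ^ ℓ + (Fintype.card Q - 1) * (a - b) ^ ℓ := by
  have hq : (Fintype.card Q : ℝ) ≠ 0 := by exact_mod_cast Fintype.card_ne_zero
  set q : ℝ := (Fintype.card Q : ℝ)
  set P : Matrix Q Q ℝ := Matrix.of fun _ _ => q⁻¹ with hP
  have hidem : IsIdempotentElem P := by
    ext i j
    simp only [hP, Matrix.mul_apply, Matrix.of_apply, sum_const, card_univ, nsmul_eq_mul]
    exact mul_inv_cancel_left₀ hq _
  have htrace : P.trace = 1 := by
    simp only [hP, Matrix.trace, Matrix.diag_apply, Matrix.of_apply, sum_const, card_univ,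
      nsmul_eq_mul]
    exact mul_inv_cancel₀ hq
  have hentry : ∀ s t, ((a + (q - 1) * b) • P + (a - b) • (1 - P)) s t =
      if s = t then a else b := by
    intro s t
    simp only [hP, Matrix.add_apply, Matrix.smul_apply, Matrix.sub_apply, Matrix.one_apply,
      Matrix.of_apply, smul_eq_mul]
    split_ifs <;> field_simp <;> ring
  simp_rw [← hentry]
  rw [sum_prod_cyclic_eq_trace_pow, smul_add_smul_one_sub_pow hidem, Matrix.trace_add,
    Matrix.trace_smul, Matrix.trace_smul, Matrix.trace_sub, Matrix.trace_one, htrace]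
  simp only [smul_eq_mul, mul_one, q]
  ring

end ClosedWalks

section ColourClasses

theorem card_filter_mem_powersetCard {V : Type*} [DecidableEq V] {k : ℕ} {S : Finset V} {u w : V}
    (hk : 2 ≤ k) (huw : u ≠ w) (hu : u ∈ S) (hw : w ∈ S) :
    #{A ∈ powersetCard k S | u ∈ A ∧ w ∈ A} = (#S - 2).choose (k - 2) := by
  have hpair : #{u, w} = 2 := card_pair huw
  have hcard := card_filter_powersetCard_subset {u, w} S k
    (insert_subset hu (singleton_subset_iff.2 hw)) (hpair.trans_le hk)
  simpa only [hpair, insert_subset_iff, singleton_subset_iff] using hcard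

variable {V Q : Type*} [Fintype V] [DecidableEq Q] {k : ℕ} {σ : V → Q} {A : Finset V} {u w : V}

/-- The vertices of colour `i`. -/
def colourClass (σ : V → Q) (i : Q) : Finset V := {v | σ v = i}

theorem mem_colourClass {i : Q} : u ∈ colourClass σ i ↔ σ u = i := mem_filter_univ u

theorem not_one_lt_card_image_iff (hu : u ∈ A) :
    ¬ 1 < #(A.image σ) ↔ A ⊆ colourClass σ (σ u) := by
  simp only [not_lt, card_le_one, forall_mem_image, subset_iff, mem_colourClass]
  exact ⟨fun h v hv => h hv hu, fun h v hv v' hv' => (h hv).trans (h hv').symm⟩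

/-- The `k`-sets of vertices that are not monochromatic, that is, the possible edges of a
hypergraph for which `σ` is a colouring. -/
def bichromaticSets (k : ℕ) (σ : V → Q) : Finset (Finset V) :=
  {A ∈ powersetCard k univ | 1 < #(A.image σ)}

theorem card_bichromaticSets_add [Fintype Q] (hk : k ≠ 0) (σ : V → Q) :
    #(bichromaticSets k σ) + ∑ i, (#(colourClass σ i)).choose k = (Fintype.card V).choose k := by
  have hdisj : ((univ : Finset Q) : Set Q).PairwiseDisjoint
      fun i => powersetCard k (colourClass σ i) := by
    refine fun i _ j _ hij => disjoint_left.2 fun A hAi hAj => hij ?_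
    rw [mem_powersetCard] at hAi hAj
    obtain ⟨u, hu⟩ := card_ne_zero.1 (hAi.2.trans_ne hk)
    exact (mem_colourClass.1 (hAi.1 hu)).symm.trans (mem_colourClass.1 (hAj.1 hu))
  have hmono : {A ∈ powersetCard k (univ : Finset V) | ¬ 1 < #(A.image σ)} =
      univ.disjiUnion (fun i => powersetCard k (colourClass σ i)) hdisj := by
    ext A
    simp only [mem_filter, mem_disjiUnion, mem_univ, true_and, mem_powersetCard, subset_univ]
    constructor
    · rintro ⟨hA, hmono⟩
      obtain ⟨u, hu⟩ := card_ne_zero.1 (hA.trans_ne hk)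
      exact ⟨σ u, (not_one_lt_card_image_iff hu).1 hmono, hA⟩
    · rintro ⟨i, hAi, hA⟩
      obtain ⟨u, hu⟩ := card_ne_zero.1 (hA.trans_ne hk)
      refine ⟨hA, (not_one_lt_card_image_iff hu).2 ?_⟩
      rwa [mem_colourClass.1 (hAi hu)]
  have hsplit := card_filter_add_card_filter_not (s := powersetCard k (univ : Finset V))
    fun A => 1 < #(A.image σ)
  rwa [hmono, card_disjiUnion, sum_congr rfl fun i _ => card_powersetCard k _, card_powersetCard,
    card_univ] at hsplit

theorem card_filter_mem_bichromaticSets_add [DecidableEq V] (hk : 2 ≤ k) (σ : V → Q)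
    (huw : u ≠ w) :
    #{A ∈ bichromaticSets k σ | u ∈ A ∧ w ∈ A} +
      (if σ u = σ w then (#(colourClass σ (σ u)) - 2).choose (k - 2) else 0) =
      (Fintype.card V - 2).choose (k - 2) := by
  rw [← card_univ, ← card_filter_mem_powersetCard hk huw (mem_univ u) (mem_univ w),
    ← card_filter_add_card_filter_not (s := {A ∈ powersetCard k univ | u ∈ A ∧ w ∈ A})
      fun A => 1 < #(A.image σ), bichromaticSets, filter_comm]
  congr 1
  rw [filter_congr fun A hA => not_one_lt_card_image_iff (mem_filter.1 hA).2.1]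
  split_ifs with h
  · rw [← card_filter_mem_powersetCard hk huw (mem_colourClass.2 rfl) (mem_colourClass.2 h.symm)]
    congr 1
    ext A
    simp only [mem_filter, mem_powersetCard, subset_univ, true_and]
    tauto
  · refine (card_eq_zero.2 (filter_eq_empty_iff.2 fun A hA hsub => h ?_)).symm
    exact (mem_colourClass.1 (hsub (mem_filter.1 hA).2.2)).symm

end ColourClasses

section EdgeFamily

variable {X V : Type*} [Fintype X] {E : X → Finset V} {F : Finset (Finset V)}

theorem card_filter_comp_eq (hE : Function.Injective E) (hF : ∀ A, A ∈ F ↔ ∃ x, E x = A)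
    (p : Finset V → Prop) [DecidablePred p] : #{x | p (E x)} = #{A ∈ F | p A} := by
  refine card_bij (fun x _ => E x) (fun x hx => ?_) (fun x _ y _ h => hE h) fun A hA => ?_
  · exact mem_filter.2 ⟨(hF _).2 ⟨x, rfl⟩, (mem_filter_univ x).1 hx⟩
  · obtain ⟨x, rfl⟩ := (hF A).1 (mem_filter.1 hA).1
    exact ⟨x, (mem_filter_univ x).2 (mem_filter.1 hA).2, rfl⟩

theorem codegree_eq_card_filter [DecidableEq V] (hE : Function.Injective E)
    (hF : ∀ A, A ∈ F ↔ ∃ x, E x = A) (u w : V) :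
    codegree E u w = #{A ∈ F | u ∈ A ∧ w ∈ A} := by
  rw [← card_filter_comp_eq hE hF, codegree]
  congr!

end EdgeFamily

section InjectiveMaps

theorem card_filter_injective {J V : Type*} [Fintype J] [DecidableEq J] [Fintype V]
    [DecidableEq V] :
    #{v : J → V | Function.Injective v} = (Fintype.card V).descFactorial (Fintype.card J) := by
  rw [← Fintype.card_subtype, ← Fintype.card_embedding_eq]
  exact Fintype.card_congr (Equiv.subtypeInjectiveEquivEmbedding _ _)

variable {J V Q : Type*} [Fintype J] [DecidableEq J] [Fintype V] [DecidableEq Q]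

theorem card_filter_comp_eq_prod (σ : V → Q) (s : J → Q) :
    #{v : J → V | σ ∘ v = s} = ∏ a, #(colourClass σ (s a)) := by
  rw [← Fintype.card_piFinset]
  congr 1
  ext v
  simp [Fintype.mem_piFinset, mem_colourClass, funext_iff]

variable [DecidableEq V]

theorem card_filter_injective_and_comp_le (σ : V → Q) (s : J → Q) :
    #{v : J → V | Function.Injective v ∧ σ ∘ v = s} ≤ ∏ a, #(colourClass σ (s a)) := by
  rw [← card_filter_comp_eq_prod]
  exact card_le_card (monotone_filter_right _ fun v _ hv => hv.2)

theorem prod_card_colourClass_add_descFactorial_le (σ : V → Q) (s : J → Q) :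
    ∏ a, #(colourClass σ (s a)) + (Fintype.card V).descFactorial (Fintype.card J) ≤
      #{v : J → V | Function.Injective v ∧ σ ∘ v = s} + Fintype.card V ^ Fintype.card J := by
  rw [← card_filter_comp_eq_prod, ← card_filter_injective, ← Fintype.card_fun, add_comm,
    ← card_union_add_card_inter, ← filter_and, add_comm]
  gcongr
  exact card_le_univ _

end InjectiveMaps

section CycleWeight

variable {ι Q : Type*} {l : Filter ι} [DecidableEq Q] {N : ι → ℕ} {σ : ∀ i, Fin (N i) → Q}
  {ρ : Q → ℝ} {ℓ : ℕ} [NeZero ℓ]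

theorem tendsto_natCast_div_self (hN : Tendsto N l atTop) :
    Tendsto (fun i => (N i : ℝ) / N i) l (𝓝 1) := by
  refine tendsto_const_nhds.congr' ?_
  filter_upwards [hN.eventually_ne_atTop 0] with i hi
  exact (div_self (Nat.cast_ne_zero.2 hi)).symm

theorem tendsto_card_injective_and_comp_div (hN : Tendsto N l atTop)
    (hσ : ∀ j, Tendsto (fun i => (#(colourClass (σ i) j) : ℝ) / N i) l (𝓝 (ρ j)))
    (s : ZMod ℓ → Q) :
    Tendsto (fun i => (#{v : ZMod ℓ → Fin (N i) | Function.Injective v ∧ σ i ∘ v = s} : ℝ) /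
      (N i : ℝ) ^ ℓ) l (𝓝 (∏ a, ρ (s a))) := by
  have hprod : Tendsto (fun i => (∏ a, #(colourClass (σ i) (s a)) : ℝ) / (N i : ℝ) ^ ℓ) l
      (𝓝 (∏ a, ρ (s a))) := by
    refine (tendsto_finsetProd univ fun a _ => hσ (s a)).congr fun i => ?_
    rw [prod_div_distrib, prod_const, card_univ, ZMod.card]
  have hself := tendsto_natCast_div_self hN
  have hlow : Tendsto (fun i => (∏ a, #(colourClass (σ i) (s a)) : ℝ) / (N i : ℝ) ^ ℓ +
      ((N i).descFactorial ℓ : ℝ) / (N i : ℝ) ^ ℓ - ((N i : ℝ) / N i) ^ ℓ) l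
      (𝓝 (∏ a, ρ (s a))) := by
    simpa using (hprod.add (tendsto_descFactorial_div hN hself ℓ)).sub (hself.pow ℓ)
  refine tendsto_of_tendsto_of_tendsto_of_le_of_le hlow hprod (fun i => ?_) fun i => ?_
  · have hle := prod_card_colourClass_add_descFactorial_le (σ i) s
    rw [Fintype.card_fin, ZMod.card] at hle
    dsimp only
    rw [div_pow, ← add_div, ← sub_div]
    gcongr
    rw [sub_le_iff_le_add]
    exact_mod_cast hle
  · dsimp only
    gcongr
    exact_mod_cast card_filter_injective_and_comp_le (σ i) s

theorem tendsto_cycleWeight_div [Fintype Q] {X : ι → Type*} [∀ i, Fintype (X i)]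
    {E : ∀ i, X i → Finset (Fin (N i))} {D : ι → Q → Q → ℝ} {w : Q → Q → ℝ} {r : ℕ}
    (hℓ : 2 ≤ ℓ) (hN : Tendsto N l atTop)
    (hσ : ∀ j, Tendsto (fun i => (#(colourClass (σ i) j) : ℝ) / N i) l (𝓝 (ρ j)))
    (hD : ∀ s t, Tendsto (fun i => D i s t / (N i : ℝ) ^ r) l (𝓝 (w s t)))
    (hE : ∀ i u v, u ≠ v → (codegree (E i) u v : ℝ) = D i (σ i u) (σ i v)) :
    Tendsto (fun i => cycleWeight (E i) ℓ / (N i : ℝ) ^ ((r + 1) * ℓ)) l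
      (𝓝 (∑ s : ZMod ℓ → Q, ∏ a, (ρ (s a) * w (s a) (s (a + 1))))) := by
  have : Fact (1 < ℓ) := ⟨hℓ⟩
  have hcycle : ∀ i, cycleWeight (E i) ℓ = ∑ s : ZMod ℓ → Q,
      #{v : ZMod ℓ → Fin (N i) | Function.Injective v ∧ σ i ∘ v = s} *
        ∏ a, D i (s a) (s (a + 1)) := by
    intro i
    rw [cycleWeight, ← sum_fiberwise _ fun v => σ i ∘ v]
    refine sum_congr rfl fun s _ => ?_
    rw [filter_filter, ← nsmul_eq_mul, ← sum_const]
    refine sum_congr rfl fun v hv => prod_congr rfl fun a _ => ?_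
    obtain ⟨hinj, rfl⟩ := (mem_filter_univ v).1 hv
    rw [hE i _ _ (hinj.ne (by simp : a ≠ a + 1)), Function.comp_apply, Function.comp_apply]
  simp_rw [prod_mul_distrib]
  refine (tendsto_finsetSum _ fun s _ => (tendsto_card_injective_and_comp_div hN hσ s).mul
    (tendsto_finsetProd _ fun a _ => hD (s a) (s (a + 1)))).congr fun i => ?_
  rw [hcycle, sum_div]
  refine sum_congr rfl fun s _ => ?_
  rw [prod_div_distrib, prod_const, card_univ, ZMod.card, div_mul_div_comm, ← pow_mul, ← pow_add,
    add_one_mul, add_comm ℓ]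

end CycleWeight

section CycleEvents

variable {ι : Type*} {l : Filter ι} {k L q ℓ : ℕ} {N m : ι → ℕ} {c : ℝ}

open Classical in
theorem cycleEvent_iff {n M : ℕ} {x : ℕ → ℕ} {H : MultiHypergraph n k M} :
    CycleEvent L x H ↔ ∀ ℓ, 2 ≤ ℓ → ℓ ≤ L →
      #{A : Finset (Fin M) | IsLooseCycleOn (fun j => (H j).1) ℓ A} = x ℓ := by
  simp only [CycleEvent, cycleCount, isLooseCycle_iff_isLooseCycleOn]

theorem natCast_factorial_add_two (r : ℕ) :
    ((r + 2).factorial : ℝ) = (r + 2) * (r + 1) * r.factorial := by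
  rw [Nat.factorial_succ, Nat.factorial_succ]
  push_cast
  ring

theorem div_pow_mul_pow_eq_lam (r ℓ : ℕ) (c : ℝ) :
    (c / (1 / (r + 2).factorial)) ^ ℓ * (1 / (r.factorial : ℝ)) ^ ℓ / (2 * ℓ) =
      lam (r + 2) c ℓ := by
  have hr : (r.factorial : ℝ) ≠ 0 := by exact_mod_cast r.factorial_ne_zero
  rw [lam, ← mul_pow, natCast_factorial_add_two]
  congr 2
  push_cast
  field_simp
  ring

theorem div_pow_mul_add_eq_lam_mul (hq : 2 ≤ q) (r ℓ : ℕ) (c : ℝ) :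
    (c / ((1 - 1 / (q : ℝ) ^ (r + 1)) / (r + 2).factorial)) ^ ℓ *
        (((1 - 1 / (q : ℝ) ^ (r + 1)) / r.factorial) ^ ℓ +
          (q - 1) * (-(1 / (q : ℝ) ^ (r + 1)) / r.factorial) ^ ℓ) / (2 * ℓ) =
      lam (r + 2) c ℓ * (1 + del (r + 2) q ℓ) := by
  have hp1 : 1 < (q : ℝ) ^ (r + 1) := one_lt_pow₀ (by exact_mod_cast hq) r.succ_ne_zero
  have hr : (r.factorial : ℝ) ≠ 0 := by exact_mod_cast r.factorial_ne_zero
  have hsub : (r + 2 : ℕ) - 1 = r + 1 := rfl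
  rw [lam, del, natCast_factorial_add_two, hsub]
  push_cast
  generalize (q : ℝ) ^ (r + 1) = p at *
  have hp : p ≠ 0 := by positivity
  have hp0 : p - 1 ≠ 0 := sub_ne_zero.2 hp1.ne'
  have hconst : c / ((1 - 1 / p) / ((r + 2) * (r + 1) * r.factorial)) *
      ((1 - 1 / p) / r.factorial) = c * (r + 2) * (r + 2 - 1) := by
    field_simp
    ring
  have hpotts : c / ((1 - 1 / p) / ((r + 2) * (r + 1) * r.factorial)) *
      (-(1 / p) / r.factorial) = c * (r + 2) * (r + 2 - 1) * (-1 / (p - 1)) := by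
    field_simp
    ring
  rw [mul_add, mul_left_comm, ← mul_pow, ← mul_pow, hconst, hpotts, mul_pow _ (-1 / (p - 1)),
    div_pow]
  ring

theorem tendsto_prob_cycleEvent (hk : 2 ≤ k) (hN : Tendsto N l atTop)
    (hm : Tendsto (fun i => (m i : ℝ) / N i) l (𝓝 c)) (x : ℕ → ℕ) :
    Tendsto (fun i => prob fun H : MultiHypergraph (N i) k (m i) => CycleEvent L x H) l
      (𝓝 (∏ ℓ ∈ Icc 2 L, poissonProb (lam k c ℓ) (x ℓ))) := by
  obtain ⟨r, rfl⟩ : ∃ r, k = r + 2 := ⟨k - 2, by omega⟩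
  have hself := tendsto_natCast_div_self hN
  have hdens : Tendsto (fun i => (Fintype.card {e : Finset (Fin (N i)) // #e = r + 2} : ℝ) /
      (N i : ℝ) ^ (r + 2)) l (𝓝 (1 / (r + 2).factorial)) := by
    simpa using tendsto_choose_div hN hself (r + 2)
  have hcodeg : ∀ i u v, u ≠ v →
      (codegree (Subtype.val : {e : Finset (Fin (N i)) // #e = r + 2} → _) u v : ℝ) =
        (N i - 2).choose r := by
    intro i u v huv
    rw [codegree_eq_card_filter (F := powersetCard (r + 2) univ) Subtype.val_injective (by simp),
      card_filter_mem_powersetCard hk huv (mem_univ u) (mem_univ v), card_univ, Fintype.card_fin,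
      Nat.add_sub_cancel]
  have hD : Tendsto (fun i => ((N i - 2).choose r : ℝ) / (N i : ℝ) ^ r) l
      (𝓝 (1 / r.factorial)) := by
    simpa using tendsto_choose_div hN (tendsto_tsub_div hN hself 2) r
  have hcycle (ℓ : ℕ) [NeZero ℓ] (hℓ : 2 ≤ ℓ) (_ : ℓ ≤ L) :=
    tendsto_cycleWeight_div (σ := fun i _ => ()) (ρ := fun _ => 1)
      (D := fun i _ _ => ((N i - 2).choose r : ℝ)) hℓ hN
      (fun j => by simpa [colourClass] using hself) (fun _ _ => hD) hcodeg
  simp only [one_mul, prod_const, sum_const, card_univ, Fintype.card_unique, ZMod.card,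
    one_smul] at hcycle
  have hlim := tendsto_prob_card_isLooseCycleOn (τ := fun ℓ => (1 / (r.factorial : ℝ)) ^ ℓ)
    (fun i => Subtype.val_injective) (fun i A => A.2) hk hN hm (by positivity) hdens
    hcycle x
  simp_rw [div_pow_mul_pow_eq_lam] at hlim
  exact hlim.congr fun i => prob_congr fun H => cycleEvent_iff.symm

/-- The `k`-sets that are not monochromatic under `σ`, as a subtype of the type of `k`-sets from
which the edges of a hypergraph are drawn. -/
abbrev BichromaticEdge {V Q : Type*} [DecidableEq Q] (k : ℕ) (σ : V → Q) : Type _ :=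
  {e : {e : Finset V // #e = k} // 1 < #(e.1.image σ)}

section BichromaticEdge

variable {V Q : Type*} [Fintype V] [DecidableEq Q] (σ : V → Q)

theorem mem_bichromaticSets_iff_exists (A : Finset V) :
    A ∈ bichromaticSets k σ ↔ ∃ x : BichromaticEdge k σ, x.1.1 = A := by
  simp [bichromaticSets, and_comm]

theorem card_bichromaticEdge_add [Fintype Q] (hk : k ≠ 0) :
    Fintype.card (BichromaticEdge k σ) + ∑ i, (#(colourClass σ i)).choose k =
      (Fintype.card V).choose k := by
  have hcard := card_filter_comp_eq (E := fun x : BichromaticEdge k σ => x.1.1)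
    (Subtype.val_injective.comp Subtype.val_injective) (mem_bichromaticSets_iff_exists σ)
    fun _ => True
  rw [filter_true, filter_true, card_univ] at hcard
  rw [hcard, card_bichromaticSets_add hk]

theorem codegree_bichromaticEdge_add (hk : 2 ≤ k) {u w : V} (huw : u ≠ w) :
    codegree (fun x : BichromaticEdge k σ => x.1.1) u w +
      (if σ u = σ w then (#(colourClass σ (σ u)) - 2).choose (k - 2) else 0) =
      (Fintype.card V - 2).choose (k - 2) := by
  classical
  rw [codegree_eq_card_filter (E := fun x : BichromaticEdge k σ => x.1.1)
    (Subtype.val_injective.comp Subtype.val_injective)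
    (mem_bichromaticSets_iff_exists σ), card_filter_mem_bichromaticSets_add hk σ huw]

end BichromaticEdge

section Planted

variable {σ : ∀ i, Fin (N i) → Fin q}

theorem tendsto_card_bichromaticEdge_div (hk : k ≠ 0) (hq : q ≠ 0) (hN : Tendsto N l atTop)
    (hσ : ∀ j, Tendsto (fun i => (#(colourClass (σ i) j) : ℝ) / N i) l (𝓝 (1 / q))) :
    Tendsto (fun i => (Fintype.card (BichromaticEdge k (σ i)) : ℝ) / (N i : ℝ) ^ k) l
      (𝓝 ((1 - 1 / (q : ℝ) ^ (k - 1)) / k.factorial)) := by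
  obtain ⟨s, rfl⟩ : ∃ s, k = s + 1 := Nat.exists_eq_succ_of_ne_zero hk
  have hlim := (tendsto_choose_div hN (tendsto_natCast_div_self hN) (s + 1)).sub
    (tendsto_finsetSum univ fun j _ => tendsto_choose_div hN (hσ j) (s + 1))
  have hval : (1 : ℝ) ^ (s + 1) / (s + 1).factorial -
      ∑ _j : Fin q, (1 / (q : ℝ)) ^ (s + 1) / (s + 1).factorial =
      (1 - 1 / (q : ℝ) ^ s) / (s + 1).factorial := by
    rw [sum_const, card_univ, Fintype.card_fin, nsmul_eq_mul, div_pow, pow_succ (q : ℝ)]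
    field_simp
    ring
  rw [hval] at hlim
  refine hlim.congr fun i => ?_
  rw [← sum_div, ← sub_div]
  congr 1
  have hcard := card_bichromaticEdge_add (σ i) hk
  rw [Fintype.card_fin] at hcard
  rw [← hcard]
  push_cast
  ring

theorem tendsto_cycleWeight_bichromaticEdge_div [NeZero ℓ] (hℓ : 2 ≤ ℓ) (hk : 2 ≤ k) (hq : q ≠ 0)
    (hN : Tendsto N l atTop)
    (hσ : ∀ j, Tendsto (fun i => (#(colourClass (σ i) j) : ℝ) / N i) l (𝓝 (1 / q))) :
    Tendsto (fun i => cycleWeight (fun x : BichromaticEdge k (σ i) => x.1.1) ℓ /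
        (N i : ℝ) ^ ((k - 1) * ℓ)) l
      (𝓝 (((1 - 1 / (q : ℝ) ^ (k - 1)) / (k - 2).factorial) ^ ℓ +
        (q - 1) * (-(1 / (q : ℝ) ^ (k - 1)) / (k - 2).factorial) ^ ℓ)) := by
  obtain ⟨r, rfl⟩ : ∃ r, k = r + 2 := ⟨k - 2, by omega⟩
  have : NeZero q := ⟨hq⟩
  have hchoose := tendsto_choose_div hN (tendsto_tsub_div hN (tendsto_natCast_div_self hN) 2) r
  have hD : ∀ s t : Fin q, Tendsto (fun i => (((N i - 2).choose r : ℝ) -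
      if s = t then ((#(colourClass (σ i) s) - 2).choose r : ℝ) else 0) / (N i : ℝ) ^ r) l
      (𝓝 (if s = t then (1 - (1 / (q : ℝ)) ^ r) / r.factorial else 1 / r.factorial)) := by
    intro s t
    split_ifs
    · simpa only [one_pow, sub_div] using
        hchoose.sub (tendsto_choose_div hN (tendsto_tsub_div hN (hσ s) 2) r)
    · simpa using hchoose
  have hlim := tendsto_cycleWeight_div (E := fun i (x : BichromaticEdge (r + 2) (σ i)) => x.1.1)
    hℓ hN hσ hD fun i u v huv => by
      have hcodeg := codegree_bichromaticEdge_add (σ i) hk huv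
      rw [Fintype.card_fin, Nat.add_sub_cancel] at hcodeg
      rw [← hcodeg]
      split_ifs <;> simp
  simp only [mul_ite] at hlim
  rw [sum_prod_cyclic_ite, Fintype.card_fin] at hlim
  have hsub : r + 2 - 1 = r + 1 := rfl
  convert hlim using 5
  all_goals
    rw [Nat.add_sub_cancel, hsub, one_div_pow, pow_succ]
    field_simp
    ring

theorem one_sub_one_div_pow_div_factorial_pos (hk : 2 ≤ k) (hq : 2 ≤ q) :
    0 < (1 - 1 / (q : ℝ) ^ (k - 1)) / k.factorial := by
  have hq1 : (1 : ℝ) < q := by exact_mod_cast hq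
  have : 1 / (q : ℝ) ^ (k - 1) < 1 :=
    (div_lt_one (by positivity)).2 (one_lt_pow₀ hq1 (by omega))
  exact div_pos (by linarith) (by positivity)

theorem eventually_nonempty_bichromaticEdge (hk : 2 ≤ k) (hq : 2 ≤ q) (hN : Tendsto N l atTop)
    (hσ : ∀ j, Tendsto (fun i => density (σ i) j) l (𝓝 (1 / q))) :
    ∀ᶠ i in l, Nonempty (BichromaticEdge k (σ i)) := by
  filter_upwards [(tendsto_card_bichromaticEdge_div (by omega) (by omega) hN hσ).eventually_ne
    (one_sub_one_div_pow_div_factorial_pos hk hq).ne'] with i hi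
  by_contra hempty
  rw [not_nonempty_iff, ← Fintype.card_eq_zero_iff] at hempty
  simp [hempty] at hi

theorem tendsto_prob_cycleEvent_of_tendsto_density (hk : 2 ≤ k) (hq : 2 ≤ q)
    (hN : Tendsto N l atTop) (hm : Tendsto (fun i => (m i : ℝ) / N i) l (𝓝 c))
    (hσ : ∀ j, Tendsto (fun i => density (σ i) j) l (𝓝 (1 / q))) (x : ℕ → ℕ) :
    Tendsto (fun i => prob fun H : Fin (m i) → BichromaticEdge k (σ i) =>
      CycleEvent L x fun j => (H j).1) l
      (𝓝 (∏ ℓ ∈ Icc 2 L, poissonProb (lam k c ℓ * (1 + del k q ℓ)) (x ℓ))) := by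
  have hlim := tendsto_prob_card_isLooseCycleOn (L := L)
    (E := fun i (x : BichromaticEdge k (σ i)) => x.1.1)
    (fun i => Subtype.val_injective.comp Subtype.val_injective) (fun i A => A.1.2) hk hN hm
    (one_sub_one_div_pow_div_factorial_pos hk hq)
    (tendsto_card_bichromaticEdge_div (by omega) (by omega) hN hσ)
    (fun ℓ _ hℓ _ => tendsto_cycleWeight_bichromaticEdge_div hℓ hk (by omega) hN hσ) x
  obtain ⟨r, rfl⟩ : ∃ r, k = r + 2 := ⟨k - 2, by omega⟩
  simp only [Nat.add_sub_cancel, show r + 2 - 1 = r + 1 from rfl,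
    div_pow_mul_add_eq_lam_mul hq] at hlim
  exact hlim.congr fun i => prob_congr fun H => cycleEvent_iff.symm

end Planted

end CycleEvents

section FirstMoment

section Conditioning

variable {n k m q : ℕ} {w : ℝ}

theorem condProb_isColouring (S : MultiHypergraph n k m → Prop) (σ : Fin n → Fin q) :
    condProb S (fun H => IsColouring H σ) =
      prob fun H : Fin m → BichromaticEdge k σ => S fun j => (H j).1 := by
  classical
  refine (expect_bij (fun (H : Fin m → BichromaticEdge k σ) _ j => (H j).1)
    (fun H _ => ?_) (fun H _ => rfl) ?_ ?_).symm
  · exact mem_filter.2 ⟨mem_univ _, fun j => (H j).2⟩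
  · exact fun H _ H' _ h => funext fun j => Subtype.ext (congrFun h j)
  · exact fun H hH => ⟨fun j => ⟨H j, (mem_filter.1 hH).2 j⟩, mem_univ _, rfl⟩

theorem prob_isColouring_pos {σ : Fin n → Fin q} (h : Nonempty (BichromaticEdge k σ)) :
    0 < prob fun H : MultiHypergraph n k m => IsColouring H σ := by
  classical
  obtain ⟨e⟩ := h
  have : Nonempty {e : Finset (Fin n) // #e = k} := ⟨e.1⟩
  rw [prob_eq_card_div]
  have hconst : (fun _ => e.1) ∈ ({H | IsColouring H σ} : Finset (MultiHypergraph n k m)) :=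
    mem_filter.2 ⟨mem_univ _, fun _ => e.2⟩
  exact div_pos (Nat.cast_pos.2 (card_pos.2 ⟨_, hconst⟩)) (Nat.cast_pos.2 Fintype.card_pos)

open Classical in
theorem condMean_eq_expect_div_prob (X : MultiHypergraph n k m → ℝ)
    (S : MultiHypergraph n k m → Prop) :
    condMean X S = (𝔼 H, if S H then X H else 0) / prob S := by
  rw [condMean, prob_eq_card_div, expect_eq_sum_div_card, Fintype.expect_eq_sum_div_card,
    sum_filter]
  rcases isEmpty_or_nonempty (MultiHypergraph n k m) with hΩ | hΩ
  · simp
  · exact (div_div_div_cancel_right₀ (by exact_mod_cast Fintype.card_ne_zero) _ _).symm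

theorem condProb_mul_prob (S : MultiHypergraph n k m → Prop) {T : MultiHypergraph n k m → Prop}
    (hT : prob T ≠ 0) : condProb S T * prob T = prob fun H => S H ∧ T H := by
  rw [condProb, condMean_eq_expect_div_prob, div_mul_cancel₀ _ hT, prob]
  exact expect_congr rfl fun H _ => by split_ifs <;> simp_all

open Classical in
theorem mean_balancedCount :
    mean (fun H : MultiHypergraph n k m => (balancedCount q w H : ℝ)) =
      ∑ σ : Fin n → Fin q with IsBalanced w σ,
        prob fun H : MultiHypergraph n k m => IsColouring H σ := by
  rw [sum_prob_eq_expect]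
  simp only [mean, balancedCount, filter_filter]

open Classical in
theorem condMean_balancedCount (E : MultiHypergraph n k m → Prop) :
    condMean (fun H => (balancedCount q w H : ℝ)) E =
      (∑ σ : Fin n → Fin q with IsBalanced w σ,
        prob fun H : MultiHypergraph n k m => E H ∧ IsColouring H σ) / prob E := by
  rw [condMean_eq_expect_div_prob, sum_prob_eq_expect]
  congr 1
  refine expect_congr rfl fun H _ => ?_
  split_ifs with hE <;> simp [balancedCount, filter_filter, hE]

theorem abs_sum_prob_and_div_sum_prob_sub_lt {β : Type*} {s : Finset β}
    {S : MultiHypergraph n k m → Prop} {T : β → MultiHypergraph n k m → Prop} {p ε : ℝ}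
    (hs : s.Nonempty) (hT : ∀ b ∈ s, 0 < prob (T b))
    (hS : ∀ b ∈ s, |condProb S (T b) - p| < ε) :
    |(∑ b ∈ s, prob fun H => S H ∧ T b H) / ∑ b ∈ s, prob (T b) - p| < ε := by
  have hmem : s.centerMass (fun b => prob (T b)) (fun b => condProb S (T b)) ∈ Metric.ball p ε :=
    (convex_ball p ε).centerMass_mem (fun b hb => (hT b hb).le) (sum_pos hT hs) hS
  have hcenter : s.centerMass (fun b => prob (T b)) (fun b => condProb S (T b)) =
      (∑ b ∈ s, prob fun H => S H ∧ T b H) / ∑ b ∈ s, prob (T b) := by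
    rw [centerMass, smul_eq_mul, inv_mul_eq_div]
    congr 1
    refine sum_congr rfl fun b hb => ?_
    rw [smul_eq_mul, mul_comm, condProb_mul_prob S (hT b hb).ne']
  rwa [hcenter] at hmem

end Conditioning

section Asymptotics

variable {k q L : ℕ} {ω : ℕ → ℝ} {m : ℕ → ℕ} {c : ℝ}

/-- The balanced maps on all vertex sets `Fin n` together; a limit along
`comap Sigma.fst atTop` is a limit as `n → ∞` that is uniform over the balanced maps. -/
abbrev BalancedMap (q : ℕ) (ω : ℕ → ℝ) : Type :=
  Σ n : ℕ, {σ : Fin n → Fin q // IsBalanced (ω n) σ}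

theorem eventually_balancedMap_iff {P : ∀ n, (Fin n → Fin q) → Prop} :
    (∀ᶠ s : BalancedMap q ω in comap Sigma.fst atTop, P s.1 s.2.1) ↔
      ∀ᶠ n in atTop, ∀ σ, IsBalanced (ω n) σ → P n σ := by
  rw [eventually_comap]
  refine eventually_congr (Eventually.of_forall fun n => ⟨fun h σ hσ => h ⟨n, σ, hσ⟩ rfl, ?_⟩)
  rintro h ⟨_, σ, hσ⟩ rfl
  exact h σ hσ

theorem tendsto_density_balancedMap (hω : Tendsto (fun n : ℕ => ω n * √n) atTop atTop)
    (j : Fin q) :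
    Tendsto (fun s : BalancedMap q ω => density s.2.1 j) (comap Sigma.fst atTop)
      (𝓝 (1 / q)) := by
  have hbound : Tendsto (fun s : BalancedMap q ω => 1 / (ω s.1 * √s.1)) (comap Sigma.fst atTop)
      (𝓝 0) :=
    (tendsto_const_nhds.div_atTop hω).comp tendsto_comap
  exact tendsto_iff_dist_tendsto_zero.2 <|
    squeeze_zero (fun _ => dist_nonneg) (fun s => s.2.2 j) hbound

theorem eventually_abs_condProb_cycleEvent_sub_lt (hk : 2 ≤ k) (hq : 2 ≤ q)
    (hm : Tendsto (fun n => (m n : ℝ) / n) atTop (𝓝 c))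
    (hω : Tendsto (fun n : ℕ => ω n * √n) atTop atTop) (x : ℕ → ℕ) {ε : ℝ} (hε : 0 < ε) :
    ∀ᶠ n in atTop, ∀ σ : Fin n → Fin q, IsBalanced (ω n) σ →
      |condProb (fun H : MultiHypergraph n k (m n) => CycleEvent L x H)
          (fun H => IsColouring H σ) -
        ∏ ℓ ∈ Icc 2 L, poissonProb (lam k c ℓ * (1 + del k q ℓ)) (x ℓ)| < ε := by
  have hlim := tendsto_prob_cycleEvent_of_tendsto_density (L := L)
    (σ := fun s : BalancedMap q ω => s.2.1) hk hq tendsto_comap (hm.comp tendsto_comap)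
    (tendsto_density_balancedMap hω) x
  rw [← eventually_balancedMap_iff]
  filter_upwards [Metric.tendsto_nhds.1 hlim ε hε] with s hs
  rwa [condProb_isColouring]

theorem eventually_prob_isColouring_pos (hk : 2 ≤ k) (hq : 2 ≤ q)
    (hω : Tendsto (fun n : ℕ => ω n * √n) atTop atTop) :
    ∀ᶠ n in atTop, ∀ σ : Fin n → Fin q, IsBalanced (ω n) σ →
      0 < prob fun H : MultiHypergraph n k (m n) => IsColouring H σ := by
  rw [← eventually_balancedMap_iff]
  exact (eventually_nonempty_bichromaticEdge (σ := fun s : BalancedMap q ω => s.2.1) hk hq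
    tendsto_comap (tendsto_density_balancedMap hω)).mono fun s hs => prob_isColouring_pos hs

theorem poissonProb_pos {μ : ℝ} (hμ : 0 < μ) (x : ℕ) : 0 < poissonProb μ x := by
  unfold poissonProb
  positivity

theorem poissonProb_mul_div {μ : ℝ} (hμ : 0 < μ) (δ : ℝ) (x : ℕ) :
    poissonProb (μ * (1 + δ)) x / poissonProb μ x = (1 + δ) ^ x * Real.exp (-(μ * δ)) := by
  rw [div_eq_iff (poissonProb_pos hμ x).ne', poissonProb, poissonProb, mul_pow, mul_one_add,
    neg_add, Real.exp_add]
  ring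

theorem lam_pos {ℓ : ℕ} (hk : 2 ≤ k) (hc : 0 < c) (hℓ : ℓ ≠ 0) : 0 < lam k c ℓ := by
  have hk1 : (0 : ℝ) < k - 1 := sub_pos.2 (by exact_mod_cast hk)
  unfold lam
  positivity

theorem tendsto_condMean_div_mean (hk : 2 ≤ k) (hq : 2 ≤ q) (hc : 0 < c)
    (hm : Tendsto (fun n => (m n : ℝ) / n) atTop (𝓝 c))
    (hω : Tendsto (fun n : ℕ => ω n * √n) atTop atTop) (x : ℕ → ℕ) :
    Tendsto (fun n =>
        condMean (fun H : MultiHypergraph n k (m n) => (balancedCount q (ω n) H : ℝ))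
          (CycleEvent L x) /
        mean fun H : MultiHypergraph n k (m n) => (balancedCount q (ω n) H : ℝ))
      (atTop ⊓ 𝓟 {n | ∃ σ : Fin n → Fin q, IsBalanced (ω n) σ})
      (𝓝 (∏ ℓ ∈ Icc 2 L, (1 + del k q ℓ) ^ x ℓ * Real.exp (-(lam k c ℓ * del k q ℓ)))) := by
  classical
  have hlam (ℓ : ℕ) (hℓ : ℓ ∈ Icc 2 L) : 0 < lam k c ℓ :=
    lam_pos hk hc (by have := mem_Icc.1 hℓ; omega)
  have hE := (tendsto_prob_cycleEvent (L := L) hk tendsto_id hm x).mono_left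
    (inf_le_left (b := 𝓟 {n | ∃ σ : Fin n → Fin q, IsBalanced (ω n) σ}))
  have hE0 : ∏ ℓ ∈ Icc 2 L, poissonProb (lam k c ℓ) (x ℓ) ≠ 0 :=
    (prod_pos fun ℓ hℓ => poissonProb_pos (hlam ℓ hℓ) _).ne'
  have hjoint : Tendsto (fun n =>
      (∑ σ : Fin n → Fin q with IsBalanced (ω n) σ,
        prob fun H : MultiHypergraph n k (m n) => CycleEvent L x H ∧ IsColouring H σ) /
      ∑ σ : Fin n → Fin q with IsBalanced (ω n) σ,
        prob fun H : MultiHypergraph n k (m n) => IsColouring H σ)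
      (atTop ⊓ 𝓟 {n | ∃ σ : Fin n → Fin q, IsBalanced (ω n) σ})
      (𝓝 (∏ ℓ ∈ Icc 2 L, poissonProb (lam k c ℓ * (1 + del k q ℓ)) (x ℓ))) := by
    refine Metric.tendsto_nhds.2 fun ε hε => eventually_inf_principal.2 ?_
    filter_upwards [eventually_prob_isColouring_pos hk hq hω,
      eventually_abs_condProb_cycleEvent_sub_lt hk hq hm hω x hε] with n hpos hcond ⟨σ, hσ⟩
    exact abs_sum_prob_and_div_sum_prob_sub_lt ⟨σ, mem_filter.2 ⟨mem_univ _, hσ⟩⟩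
      (fun τ hτ => hpos τ (mem_filter.1 hτ).2) fun τ hτ => hcond τ (mem_filter.1 hτ).2
  have hlim := hjoint.div hE hE0
  rw [← prod_div_distrib, prod_congr rfl fun ℓ hℓ =>
    poissonProb_mul_div (hlam ℓ hℓ) (del k q ℓ) (x ℓ)] at hlim
  refine hlim.congr fun n => ?_
  rw [condMean_balancedCount, mean_balancedCount]
  exact div_right_comm _ _ _

end Asymptotics

end FirstMoment

section Series

variable {k q : ℕ} {c : ℝ}

theorem summable_pow_div_natCast_iff {r : ℝ} (hr : 0 ≤ r) :
    Summable (fun n : ℕ => r ^ n / n) ↔ r < 1 := by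
  refine ⟨fun h => ?_, fun h => ?_⟩
  · by_contra! hr1
    refine Real.not_summable_one_div_natCast
      (h.of_nonneg_of_le (fun n => by positivity) fun n => ?_)
    gcongr
    exact one_le_pow₀ hr1
  · refine (summable_geometric_of_lt_one hr h).of_nonneg_of_le (fun n => by positivity)
      fun n => ?_
    rcases n.eq_zero_or_pos with rfl | hn
    · simp
    · exact div_le_self (by positivity) (by exact_mod_cast hn)

theorem lam_mul_del_sq (k q : ℕ) (c : ℝ) (ℓ : ℕ) :
    lam k c ℓ * del k q ℓ ^ 2 =
      ((q : ℝ) - 1) ^ 2 / 2 * ((c * k * (k - 1) / ((q : ℝ) ^ (k - 1) - 1) ^ 2) ^ ℓ / ℓ) := by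
  have hsign : ((-1 : ℝ) ^ ℓ) ^ 2 = 1 := by rw [← pow_mul, mul_comm, pow_mul, neg_one_sq, one_pow]
  rw [lam, del, div_pow, div_pow, mul_pow ((-1) ^ ℓ), hsign, pow_right_comm _ 2 ℓ, one_mul]
  ring

theorem summable_lam_mul_del_sq_iff (hk : 2 ≤ k) (hq : 2 ≤ q) (hc : 0 < c) :
    Summable (fun i : ℕ => lam k c (i + 2) * del k q (i + 2) ^ 2) ↔
      c * k * ((k : ℝ) - 1) < ((q : ℝ) ^ (k - 1) - 1) ^ 2 := by
  have hq1 : (0 : ℝ) < q - 1 := sub_pos.2 (by exact_mod_cast hq)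
  have hk1 : (0 : ℝ) < k - 1 := sub_pos.2 (by exact_mod_cast hk)
  have hp1 : 0 < (q : ℝ) ^ (k - 1) - 1 :=
    sub_pos.2 (one_lt_pow₀ (by exact_mod_cast hq) (by omega))
  rw [summable_nat_add_iff 2 (f := fun ℓ => lam k c ℓ * del k q ℓ ^ 2)]
  simp_rw [lam_mul_del_sq]
  rw [summable_mul_left_iff (by positivity), summable_pow_div_natCast_iff (by positivity),
    div_lt_one (by positivity)]

theorem log_three_le : Real.log 3 ≤ 7 / 6 := by
  have hadd : Real.log 3 + Real.log (4 / 3) = 2 * Real.log 2 := by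
    rw [← Real.log_mul (by norm_num) (by norm_num), show (3 : ℝ) * (4 / 3) = 2 ^ 2 by norm_num,
      Real.log_pow, Nat.cast_ofNat]
  have hlower := Real.one_sub_inv_le_log_of_pos (by norm_num : (0 : ℝ) < 4 / 3)
  norm_num at hlower
  linarith [Real.log_two_lt_d9]

theorem mul_pred_add_two_le_three_pow (hk : 3 ≤ k) :
    (7 / 6 : ℝ) * (k * (k - 1)) + 2 ≤ 3 ^ (k - 1) := by
  induction k, hk using Nat.le_induction with
  | base => norm_num
  | succ k hk ih =>
    have hk3 : (3 : ℝ) ≤ k := by exact_mod_cast hk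
    rw [Nat.add_sub_cancel, ← mul_pow_sub_one (by omega : k ≠ 0) (3 : ℝ)]
    push_cast
    nlinarith

theorem mul_log_three_pow_le (hk : 3 ≤ k) :
    k * Real.log (3 ^ (k - 1)) ≤ 3 ^ (k - 1) - 2 := by
  have hk1 : (0 : ℝ) ≤ k - 1 := sub_nonneg.2 (by exact_mod_cast (by omega : 1 ≤ k))
  rw [Real.log_pow, Nat.cast_pred (by omega)]
  calc (k : ℝ) * ((k - 1) * Real.log 3) = k * (k - 1) * Real.log 3 := by ring
    _ ≤ k * (k - 1) * (7 / 6) := by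
        gcongr
        exact log_three_le
    _ ≤ 3 ^ (k - 1) - 2 := by linarith [mul_pred_add_two_le_three_pow hk]

-- The slope `k / p` of `k * log p` is at most `1` beyond `p = 3 ^ (k - 1)`.
theorem mul_log_pow_le (hk : 3 ≤ k) (hq : 3 ≤ q) :
    k * Real.log ((q : ℝ) ^ (k - 1)) ≤ (q : ℝ) ^ (k - 1) - 2 := by
  have hk3 : (3 : ℝ) ≤ k := by exact_mod_cast hk
  have hbp : (3 : ℝ) ^ (k - 1) ≤ (q : ℝ) ^ (k - 1) :=
    pow_le_pow_left₀ (by norm_num) (by exact_mod_cast hq) _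
  have hbase := mul_log_three_pow_le hk
  have hkb : (k : ℝ) ≤ 3 ^ (k - 1) := by nlinarith [mul_pred_add_two_le_three_pow hk]
  have hb : (0 : ℝ) < 3 ^ (k - 1) := by positivity
  generalize (3 : ℝ) ^ (k - 1) = b at *
  generalize (q : ℝ) ^ (k - 1) = p at *
  have hlog : Real.log p - Real.log b ≤ p / b - 1 := by
    rw [← Real.log_div (by linarith) hb.ne']
    exact Real.log_le_sub_one_of_pos (div_pos (by linarith) hb)
  have hslope : k * (p / b - 1) ≤ p - b := by
    rw [div_sub_one hb.ne', mul_div_assoc', div_le_iff₀ hb]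
    nlinarith
  nlinarith

theorem mul_pred_lt_of_le_pow_mul_log (hk : 3 ≤ k) (hq : 3 ≤ q)
    (h : c ≤ (q : ℝ) ^ (k - 1) * Real.log q) :
    c * k * ((k : ℝ) - 1) < ((q : ℝ) ^ (k - 1) - 1) ^ 2 := by
  have hk1 : (0 : ℝ) ≤ k - 1 := sub_nonneg.2 (by exact_mod_cast (by omega : 1 ≤ k))
  have hlog := mul_log_pow_le hk hq
  calc c * k * ((k : ℝ) - 1)
      ≤ (q : ℝ) ^ (k - 1) * Real.log q * k * (k - 1) := by gcongr
    _ = (q : ℝ) ^ (k - 1) * (k * Real.log ((q : ℝ) ^ (k - 1))) := by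
        rw [Real.log_pow, Nat.cast_pred (by omega)]
        ring
    _ ≤ (q : ℝ) ^ (k - 1) * ((q : ℝ) ^ (k - 1) - 2) := by gcongr
    _ < ((q : ℝ) ^ (k - 1) - 1) ^ 2 := by nlinarith

end Series

end LooseCycles

open LooseCycles in
theorem mainTheorem6_general {k q : ℕ} (hk : 2 ≤ k) (hq : 2 ≤ q) {c : ℝ} (hc : 0 < c)
    {m : ℕ → ℕ} (hm : Tendsto (fun n => (m n : ℝ) / n) atTop (𝓝 c)) :
    (∀ ω : ℕ → ℝ, Tendsto (fun n : ℕ => ω n * √n) atTop atTop → ∀ (L : ℕ) (x : ℕ → ℕ),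
      Tendsto
        (fun n =>
          condMean (fun H : MultiHypergraph n k (m n) => (balancedCount q (ω n) H : ℝ))
            (CycleEvent L x) /
          mean fun H : MultiHypergraph n k (m n) => (balancedCount q (ω n) H : ℝ))
        (atTop ⊓ 𝓟 {n | ∃ σ : Fin n → Fin q, IsBalanced (ω n) σ})
        (𝓝 (∏ ℓ ∈ Finset.Icc 2 L,
          (1 + del k q ℓ) ^ x ℓ * Real.exp (-(lam k c ℓ * del k q ℓ))))) ∧
    (∀ ω : ℕ → ℝ, Tendsto (fun n : ℕ => ω n * √n) atTop atTop →
      ∀ (L : ℕ) (x : ℕ → ℕ) (ε : ℝ), 0 < ε →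
        ∀ᶠ n in atTop, ∀ σ : Fin n → Fin q, IsBalanced (ω n) σ →
          |condProb (fun H : MultiHypergraph n k (m n) => CycleEvent L x H)
              (fun H => IsColouring H σ) -
            ∏ ℓ ∈ Finset.Icc 2 L, poissonProb (lam k c ℓ * (1 + del k q ℓ)) (x ℓ)| < ε) ∧
    (Summable (fun i : ℕ => lam k c (i + 2) * del k q (i + 2) ^ 2) ↔
      c * k * ((k : ℝ) - 1) < ((q : ℝ) ^ (k - 1) - 1) ^ 2) ∧
    (3 ≤ k → 3 ≤ q → c ≤ (q : ℝ) ^ (k - 1) * Real.log q →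
      Summable fun i : ℕ => lam k c (i + 2) * del k q (i + 2) ^ 2) :=
  ⟨fun _ hω _ x => tendsto_condMean_div_mean hk hq hc hm hω x,
    fun _ hω _ x _ hε => eventually_abs_condProb_cycleEvent_sub_lt hk hq hm hω x hε,
    summable_lam_mul_del_sq_iff hk hq hc,
    fun hk3 hq3 h => (summable_lam_mul_del_sq_iff hk hq hc).2
      (mul_pred_lt_of_le_pow_mul_log hk3 hq3 h)⟩

theorem mainTheorem6 (k q : ℕ) (hk : 3 ≤ k) (hq : 3 ≤ q) (c : ℝ) (hc : 0 < c) :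
    -- Impact of the cycle counts on the first moment; the quotient is considered along those `n`
    -- for which a balanced map exists (otherwise it is `0 / 0`).
    (∀ ω : ℕ → ℝ, (∀ n, 0 < ω n) → Tendsto ω atTop atTop →
      ∀ (L : ℕ) (x : ℕ → ℕ),
        Tendsto
          (fun n : ℕ =>
            LooseCycles.condMean
                (fun H : LooseCycles.MultiHypergraph n k ⌊c * (n : ℝ)⌋₊ =>
                  (LooseCycles.balancedCount q (ω n) H : ℝ))
                (LooseCycles.CycleEvent L x) /
              LooseCycles.mean
                (fun H : LooseCycles.MultiHypergraph n k ⌊c * (n : ℝ)⌋₊ =>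
                  (LooseCycles.balancedCount q (ω n) H : ℝ)))
          (atTop ⊓ 𝓟 {n : ℕ | ∃ σ : Fin n → Fin q, LooseCycles.IsBalanced (ω n) σ})
          (𝓝 (∏ ℓ ∈ Finset.Icc 2 L,
            (1 + LooseCycles.del k q ℓ) ^ x ℓ *
              Real.exp (-(LooseCycles.lam k c ℓ * LooseCycles.del k q ℓ))))) ∧
    -- Given a planted balanced colouring, the cycle counts are asymptotically independent
    -- Poisson variables, uniformly in the colouring.
    (∀ ω : ℕ → ℝ, (∀ n, 0 < ω n) → Tendsto ω atTop atTop →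
      ∀ (L : ℕ) (x : ℕ → ℕ) (ε : ℝ), 0 < ε →
        ∀ᶠ n : ℕ in atTop, ∀ σ : Fin n → Fin q, LooseCycles.IsBalanced (ω n) σ →
          |LooseCycles.condProb
              (fun H : LooseCycles.MultiHypergraph n k ⌊c * (n : ℝ)⌋₊ =>
                LooseCycles.CycleEvent L x H)
              (fun H => LooseCycles.IsColouring H σ) -
            ∏ ℓ ∈ Finset.Icc 2 L,
              LooseCycles.poissonProb
                (LooseCycles.lam k c ℓ * (1 + LooseCycles.del k q ℓ)) (x ℓ)| < ε) ∧
    -- Convergence of the series `∑_{ℓ ≥ 2} λ_ℓ δ_ℓ²`: the exact range of densities,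
    (Summable (fun i : ℕ => LooseCycles.lam k c (i + 2) * LooseCycles.del k q (i + 2) ^ 2) ↔
      c * k * ((k : ℝ) - 1) < ((q : ℝ) ^ (k - 1) - 1) ^ 2) ∧
    -- which contains the whole range up to `q^(k-1) ln q`.
    (c ≤ (q : ℝ) ^ (k - 1) * Real.log q →
      Summable (fun i : ℕ =>
        LooseCycles.lam k c (i + 2) * LooseCycles.del k q (i + 2) ^ 2)) := by
  obtain ⟨hmean, hcond, hseries, hlog⟩ :=
    mainTheorem6_general (k := k) (q := q) (by omega) (by omega) hc
      ((tendsto_nat_floor_mul_div_atTop hc.le).comp tendsto_natCast_atTop_atTop)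
  have hsqrt {ω : ℕ → ℝ} (hω : Tendsto ω atTop atTop) :=
    hω.atTop_mul_atTop₀ (Real.tendsto_sqrt_atTop.comp tendsto_natCast_atTop_atTop)
  exact ⟨fun ω _ hω => hmean ω (hsqrt hω), fun ω _ hω => hcond ω (hsqrt hω), hseries,
    hlog hk hq⟩
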